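/- Let $d\ge 1$ be an integer and $q\in\mathbb C\setminus\{0\}$. **Setting.** For $n\ge 0$ the framed braid group $\mathcal F_n$ is generated by the braid generators $\sigma_1,\dots,\sigma_{n-1}$ and the framing generators $t_1,\dots,t_n$, subject to the braid relations ($\sigma_i\sigma_{i+1}\sigma_i=\sigma_{i+1}\sigma_i\sigma_{i+1}$, and $\sigma_i\sigma_j=\sigma_j\sigma_i$ for $|i-j|>1$), $t_it_j=t_jt_i$, and $t_j\sigma_i=\sigma_i t_{s_i(j)}$ with $s_i=(i\ i{+}1)$. It contains the classical braid group $B_n$. The group $\mathcal F_{d,n}$ is the quotient of $\mathcal F_n$ by $t_j^d=1$ for all $j$. The Yokonuma–Hecke algebra $\mathrm Y_{d,n}(q)$ is the quotient of $\mathbb C\mathcal F_{d,n}$ by the relations $\sigma_i^2=1+(q-q^{-1})e_i\sigma_i$, where $e_i=\frac1d\sum_{s=1}^{d}t_i^st_{i+1}^{-s}$; write $g_i$ for the image of $\sigma_i$. A framed braid $\alpha\in\mathcal F_n$ is regarded as an element of $\mathrm Y_{d,n}(q)$ through the natural maps. Let $\mathrm{tr}_d:\bigcup_n \mathrm Y_{d,n}(q)\to\mathbb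 C[z,x_1,\dots,x_{d-1}]$ be Juyumaya's trace, the unique linear map (that is, the unique family of linear maps on the $\mathrm Y_{d,n}(q)$ compatible with adding a strand on the right) with $$\mathrm{tr}_d(ab)=\mathrm{tr}_d(ba),\quad \mathrm{tr}_d(1)=1,\quad \mathrm{tr}_d(a g_n)=z\,\mathrm{tr}_d(a),\quad \mathrm{tr}_d(a\,t_{n+1}^s)=x_s\,\mathrm{tr}_d(a)\ \ (1\le s\le d-1),$$ for $a,b\in \mathrm Y_{d,n}(q)$. The E-system is the system of equations $E^{(m)}=\mathrm x_mE^{(0)}$ ($1\le m\le d-1$), where $E^{(m)}=\frac1d\sum_{s\in\mathbb Z/d\mathbb Z}\mathrm x_{m+s}\mathrm x_{-s}$, the indices are taken modulo $d$, and $\mathrm x_0=1$. For a non-empty subset $D\subseteq\mathbb Z/d\mathbb Z$, $\mathrm{tr}_{d,D}:\bigcup_n\mathrm Y_{d,n}(q)\to\mathbb C[z]$ is $\mathrm{tr}_d$ with $x_1,\dots,x_{d-1}$ specialized to the solution of the E-system given by $D$, $\mathrm x_k=\frac1{|D|}\sum_{m\in D}\exp(2\pi i\,mk/d)$. **Proposition.**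 Let $m\ge1$, let $0=i_0<i_1<\dots<i_m\le n$ be integers and let $\alpha=\alpha_1\alpha_2\cdots\alpha_m\in\mathcal F_n$ (for example $\alpha\in B_n$), where $\alpha_j$ involves only the strands $i_{j-1}+1,\dots,i_j$: it belongs to the subgroup of $\mathcal F_n$ generated by the $\sigma_k$ with $i_{j-1}<k<i_j$ and the $t_k$ with $i_{j-1}<k\le i_j$. (So the closure of $\alpha$ is the split link $L_1\sqcup\dots\sqcup L_m$, together with unlinked unknots if $i_m<n$, where $L_j$ is the closure of the part of $\alpha_j$ on these strands.) Then, in $\mathbb C[z,x_1,\dots,x_{d-1}]$, $$\mathrm{tr}_d(\alpha)=\mathrm{tr}_d(\alpha_1)\,\mathrm{tr}_d(\alpha_2)\cdots\mathrm{tr}_d(\alpha_m).$$ The same identity holds in $\mathbb C[z]$ for $\mathrm{tr}_d$ with $x_1,\dots,x_{d-1}$ specialized to any solution of the E-system; in particular, for every non-empty $D\subseteq\mathbb Z/d\mathbb Z$, $$\mathrm{tr}_{d,D}(\alpha)=\mathrm{tr}_{d,D}(\alpha_1)\,\mathrm{tr}_{d,D}(\alpha_2)\cdots\mathrm{tr}_{d,D}(\alpha_m).$$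 -/

import Mathlib

noncomputable section

namespace YokonumaHecke

/-! ### Framed braid groups

Strands are numbered `0, …, n - 1`; the generator `σ_i` (`i + 1 < n`) crosses the strands
`i` and `i + 1`, and `t_j` is framing `1` on the strand `j`. -/

/-- The generators of the framed braid group on `n` strands. -/
inductive Gen (n : ℕ) : Type
  | sigma (i : ℕ) (hi : i + 1 < n) : Gen n
  | framing (j : Fin n) : Gen n

/-- The transposition `s_i = (i, i+1)` of the strands. -/
def strandSwap {n : ℕ} (i : ℕ) (hi : i + 1 < n) : Equiv.Perm (Fin n) :=
  Equiv.swap ⟨i, Nat.lt_of_succ_lt hi⟩ ⟨i + 1, hi⟩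

/-- The word `σ_i` in the free group on the generators. -/
def wordSigma {n : ℕ} (i : ℕ) (hi : i + 1 < n) : FreeGroup (Gen n) :=
  FreeGroup.of (Gen.sigma i hi)

/-- The word `t_j` in the free group on the generators. -/
def wordFraming {n : ℕ} (j : Fin n) : FreeGroup (Gen n) :=
  FreeGroup.of (Gen.framing j)

/-- The defining relators of the framed braid group: `u * v⁻¹` for every relation `u = v`. -/
inductive FramedRel (n : ℕ) : FreeGroup (Gen n) → Prop
  /-- `σ_i σ_{i+1} σ_i = σ_{i+1} σ_i σ_{i+1}` -/
  | braid (i : ℕ) (hi : i + 1 < n) (hj : i + 1 + 1 < n) :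
      FramedRel n ((wordSigma i hi * wordSigma (i + 1) hj * wordSigma i hi) *
        (wordSigma (i + 1) hj * wordSigma i hi * wordSigma (i + 1) hj)⁻¹)
  /-- `σ_i σ_j = σ_j σ_i` for `|i - j| > 1` -/
  | comm (i j : ℕ) (hi : i + 1 < n) (hj : j + 1 < n) (hij : i + 1 < j) :
      FramedRel n ((wordSigma i hi * wordSigma j hj) * (wordSigma j hj * wordSigma i hi)⁻¹)
  /-- `t_i t_j = t_j t_i` -/
  | framing_comm (i j : Fin n) :
      FramedRel n ((wordFraming i * wordFraming j) * (wordFraming j * wordFraming i)⁻¹)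
  /-- `t_j σ_i = σ_i t_{s_i(j)}` -/
  | framing_sigma (i : ℕ) (hi : i + 1 < n) (j : Fin n) :
      FramedRel n ((wordFraming j * wordSigma i hi) *
        (wordSigma i hi * wordFraming (strandSwap i hi j))⁻¹)

/-- The defining relators of the modular framed braid group: those of the framed braid group
together with `t_j ^ d`. -/
inductive ModularRel (d n : ℕ) : FreeGroup (Gen n) → Prop
  | framed (w : FreeGroup (Gen n)) (hw : FramedRel n w) : ModularRel d n w
  | modular (j : Fin n) : ModularRel d n (wordFraming j ^ d)

/-- The framed braid group `F_n`. -/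
abbrev FramedBraidGroup (n : ℕ) : Type := PresentedGroup {w | FramedRel n w}

/-- The modular framed braid group `F_{d,n}`. -/
abbrev ModularFramedBraidGroup (d n : ℕ) : Type := PresentedGroup {w | ModularRel d n w}

/-- `σ_i` in `F_n`. -/
def sigma {n : ℕ} (i : ℕ) (hi : i + 1 < n) : FramedBraidGroup n :=
  PresentedGroup.of (Gen.sigma i hi)

/-- `t_j` in `F_n`. -/
def framing {n : ℕ} (j : Fin n) : FramedBraidGroup n :=
  PresentedGroup.of (Gen.framing j)

/-- `σ_i` in `F_{d,n}`. -/
def msigma (d : ℕ) {n : ℕ} (i : ℕ) (hi : i + 1 < n) : ModularFramedBraidGroup d n :=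
  PresentedGroup.of (Gen.sigma i hi)

/-- `t_j` in `F_{d,n}`. -/
def mframing (d : ℕ) {n : ℕ} (j : Fin n) : ModularFramedBraidGroup d n :=
  PresentedGroup.of (Gen.framing j)

/-- The natural epimorphism `F_n → F_{d,n}`. -/
def reduceFraming (d n : ℕ) : FramedBraidGroup n →* ModularFramedBraidGroup d n :=
  PresentedGroup.toGroup (f := PresentedGroup.of) (by
    intro r hr
    have h : FreeGroup.lift (PresentedGroup.of (rels := {w | ModularRel d n w})) =
        PresentedGroup.mk {w | ModularRel d n w} := by
      ext a; simp [PresentedGroup.of]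
    rw [h]
    exact PresentedGroup.one_of_mem (ModularRel.framed r hr))

/-- Adding a strand on the right, on generators. -/
def Gen.castSucc {n : ℕ} : Gen n → Gen (n + 1)
  | Gen.sigma i hi => Gen.sigma i (Nat.lt_succ_of_lt hi)
  | Gen.framing j => Gen.framing j.castSucc

lemma strandSwap_castSucc {n : ℕ} (i : ℕ) (hi : i + 1 < n) (j : Fin n) :
    (strandSwap i hi j).castSucc = strandSwap i (Nat.lt_succ_of_lt hi) j.castSucc := by
  simp only [strandSwap, Equiv.swap_apply_def, Fin.ext_iff, Fin.val_castSucc]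
  split_ifs <;> simp

lemma modularRel_castSucc (d n : ℕ) (w : FreeGroup (Gen n)) (hw : ModularRel d n w) :
    ModularRel d (n + 1) (FreeGroup.map Gen.castSucc w) := by
  rcases hw with ⟨w, h⟩ | ⟨j⟩
  · refine ModularRel.framed _ ?_
    rcases h with ⟨i, hi, hj⟩ | ⟨i, j, hi, hj, hij⟩ | ⟨i, j⟩ | ⟨i, hi, j⟩
    · simpa [wordSigma, Gen.castSucc] using
        FramedRel.braid (n := n + 1) i (Nat.lt_succ_of_lt hi) (Nat.lt_succ_of_lt hj)
    · simpa [wordSigma, Gen.castSucc] using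
        FramedRel.comm (n := n + 1) i j (Nat.lt_succ_of_lt hi) (Nat.lt_succ_of_lt hj) hij
    · simpa [wordFraming, Gen.castSucc] using
        FramedRel.framing_comm (n := n + 1) i.castSucc j.castSucc
    · simpa [wordSigma, wordFraming, Gen.castSucc, strandSwap_castSucc] using
        FramedRel.framing_sigma (n := n + 1) i (Nat.lt_succ_of_lt hi) j.castSucc
  · simpa [wordFraming, Gen.castSucc] using ModularRel.modular (d := d) (n := n + 1) j.castSucc

/-- The natural inclusion `F_{d,n} → F_{d,n+1}`. -/
def addStrand (d n : ℕ) : ModularFramedBraidGroup d n →* ModularFramedBraidGroup d (n + 1) :=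
  PresentedGroup.toGroup (f := fun a => PresentedGroup.of a.castSucc) (by
    intro r hr
    have h : FreeGroup.lift (fun a : Gen n =>
          PresentedGroup.of (rels := {w | ModularRel d (n + 1) w}) a.castSucc) =
        (PresentedGroup.mk {w | ModularRel d (n + 1) w}).comp (FreeGroup.map Gen.castSucc) := by
      ext a; simp [PresentedGroup.of]
    rw [h]
    exact PresentedGroup.one_of_mem (modularRel_castSucc d n r hr))

@[simp] lemma addStrand_msigma (d : ℕ) {n : ℕ} (i : ℕ) (hi : i + 1 < n) :
    addStrand d n (msigma d i hi) = msigma d i (Nat.lt_succ_of_lt hi) := by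
  simp [addStrand, msigma, Gen.castSucc]

@[simp] lemma addStrand_mframing (d : ℕ) {n : ℕ} (j : Fin n) :
    addStrand d n (mframing d j) = mframing d j.castSucc := by
  simp [addStrand, mframing, Gen.castSucc]

/-! ### The Yokonuma–Hecke algebra -/

/-- The element `e_i = (1/d) ∑_{s=1}^{d} t_i^s t_{i+1}^{-s}` of the group algebra `ℂ F_{d,n}`. -/
def idem (d : ℕ) {n : ℕ} (i : ℕ) (hi : i + 1 < n) :
    MonoidAlgebra ℂ (ModularFramedBraidGroup d n) :=
  (1 / (d : ℂ)) • ∑ s ∈ Finset.Icc 1 d,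
    MonoidAlgebra.of ℂ (ModularFramedBraidGroup d n)
      (mframing d ⟨i, Nat.lt_of_succ_lt hi⟩ ^ s * (mframing d ⟨i + 1, hi⟩ ^ s)⁻¹)

/-- The quadratic relation `σ_i^2 = 1 + (q - q⁻¹) e_i σ_i` in `ℂ F_{d,n}`. -/
inductive QuadRel (d : ℕ) (q : ℂ) (n : ℕ) :
    MonoidAlgebra ℂ (ModularFramedBraidGroup d n) →
      MonoidAlgebra ℂ (ModularFramedBraidGroup d n) → Prop
  | quad (i : ℕ) (hi : i + 1 < n) : QuadRel d q n
      (MonoidAlgebra.of ℂ (ModularFramedBraidGroup d n) (msigma d i hi) ^ 2)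
      (1 + (q - q⁻¹) • (idem d i hi *
        MonoidAlgebra.of ℂ (ModularFramedBraidGroup d n) (msigma d i hi)))

/-- The Yokonuma–Hecke algebra `Y_{d,n}(q)`: the quotient of `ℂ F_{d,n}` by the two-sided ideal
generated by the quadratic relations. -/
abbrev YH (d : ℕ) (q : ℂ) (n : ℕ) : Type := RingQuot (QuadRel d q n)

/-- The quotient map `ℂ F_{d,n} → Y_{d,n}(q)`. -/
def toYH (d : ℕ) (q : ℂ) (n : ℕ) :
    MonoidAlgebra ℂ (ModularFramedBraidGroup d n) →ₐ[ℂ] YH d q n :=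
  RingQuot.mkAlgHom ℂ (QuadRel d q n)

/-- `g_i`, the image of `σ_i` in `Y_{d,n}(q)`. -/
def g (d : ℕ) (q : ℂ) {n : ℕ} (i : ℕ) (hi : i + 1 < n) : YH d q n :=
  toYH d q n (MonoidAlgebra.of ℂ _ (msigma d i hi))

/-- The image of `t_j` in `Y_{d,n}(q)`. -/
def t (d : ℕ) (q : ℂ) {n : ℕ} (j : Fin n) : YH d q n :=
  toYH d q n (MonoidAlgebra.of ℂ _ (mframing d j))

/-- A framed braid regarded as an element of `Y_{d,n}(q)` through the natural maps
`F_n → F_{d,n} → Y_{d,n}(q)`. -/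
def braidToYH (d : ℕ) (q : ℂ) (n : ℕ) : FramedBraidGroup n →* YH d q n :=
  ((toYH d q n : MonoidAlgebra ℂ (ModularFramedBraidGroup d n) →* YH d q n).comp
    (MonoidAlgebra.of ℂ (ModularFramedBraidGroup d n))).comp (reduceFraming d n)

/-- The inclusion `ℂ F_{d,n} → ℂ F_{d,n+1}`. -/
def groupAlgebraIncl (d n : ℕ) : MonoidAlgebra ℂ (ModularFramedBraidGroup d n) →ₐ[ℂ]
    MonoidAlgebra ℂ (ModularFramedBraidGroup d (n + 1)) :=
  MonoidAlgebra.lift ℂ _ _ ((MonoidAlgebra.of ℂ _).comp (addStrand d n))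

lemma groupAlgebraIncl_of (d n : ℕ) (x : ModularFramedBraidGroup d n) :
    groupAlgebraIncl d n (MonoidAlgebra.of ℂ _ x) = MonoidAlgebra.of ℂ _ (addStrand d n x) := by
  simp [groupAlgebraIncl]

lemma groupAlgebraIncl_idem (d : ℕ) {n : ℕ} (i : ℕ) (hi : i + 1 < n) :
    groupAlgebraIncl d n (idem d i hi) = idem d i (Nat.lt_succ_of_lt hi) := by
  simp only [idem, map_smul, map_sum, groupAlgebraIncl_of]
  simp

/-- The natural map `Y_{d,n}(q) → Y_{d,n+1}(q)`. -/
def incl (d : ℕ) (q : ℂ) (n : ℕ) : YH d q n →ₐ[ℂ] YH d q (n + 1) :=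
  RingQuot.liftAlgHom ℂ ⟨(toYH d q (n + 1)).comp (groupAlgebraIncl d n), by
    rintro _ _ ⟨i, hi⟩
    simp only [AlgHom.comp_apply, map_pow, map_add, map_one, map_smul, map_mul,
      groupAlgebraIncl_of, groupAlgebraIncl_idem, addStrand_msigma]
    have h := RingQuot.mkAlgHom_rel ℂ
      (QuadRel.quad (d := d) (q := q) (n := n + 1) i (Nat.lt_succ_of_lt hi))
    simp only [map_pow, map_add, map_one, map_smul, map_mul] at h
    exact h⟩

lemma incl_g (d : ℕ) (q : ℂ) {n : ℕ} (i : ℕ) (hi : i + 1 < n) :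
    incl d q n (g d q i hi) = g d q i (Nat.lt_succ_of_lt hi) := by
  have h : incl d q n (g d q i hi) = (toYH d q (n + 1)).comp (groupAlgebraIncl d n)
      (MonoidAlgebra.of ℂ _ (msigma d i hi)) := RingQuot.liftAlgHom_mkAlgHom_apply ..
  rw [h, AlgHom.comp_apply, groupAlgebraIncl_of, addStrand_msigma, g]

lemma incl_t (d : ℕ) (q : ℂ) {n : ℕ} (j : Fin n) :
    incl d q n (t d q j) = t d q j.castSucc := by
  have h : incl d q n (t d q j) = (toYH d q (n + 1)).comp (groupAlgebraIncl d n)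
      (MonoidAlgebra.of ℂ _ (mframing d j)) := RingQuot.liftAlgHom_mkAlgHom_apply ..
  rw [h, AlgHom.comp_apply, groupAlgebraIncl_of, addStrand_mframing, t]

lemma braidToYH_sigma (d : ℕ) (q : ℂ) {n : ℕ} (i : ℕ) (hi : i + 1 < n) :
    braidToYH d q n (sigma i hi) = g d q i hi := by
  simp [braidToYH, g, sigma, msigma, reduceFraming]

lemma braidToYH_framing (d : ℕ) (q : ℂ) {n : ℕ} (j : Fin n) :
    braidToYH d q n (framing j) = t d q j := by
  simp [braidToYH, t, framing, mframing, reduceFraming]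

/-! ### The Juyumaya trace -/

/-- The polynomial ring `ℂ[z, x_1, …, x_{d-1}]`. -/
abbrev TracePoly (d : ℕ) : Type := MvPolynomial (Option (Fin (d - 1))) ℂ

/-- The indeterminate `z`. -/
def zVar (d : ℕ) : TracePoly d := MvPolynomial.X none

/-- The indeterminate `x_s`, where `s = k + 1` runs over `1, …, d - 1`. -/
def xVar (d : ℕ) (k : Fin (d - 1)) : TracePoly d := MvPolynomial.X (some k)

/-- The rules that determine the Markov trace `tr_d`. A linear map on `⋃ n, Y_{d,n}(q)` is a
family of linear maps on the `Y_{d,n}(q)`, `n ≥ 0`, compatible with the inclusions. -/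
structure IsJuyumayaTrace (d : ℕ) (q : ℂ) (T : ∀ n : ℕ, YH d q n →ₗ[ℂ] TracePoly d) : Prop where
  map_incl : ∀ (n : ℕ) (a : YH d q n), T (n + 1) (incl d q n a) = T n a
  map_mul_comm : ∀ (n : ℕ) (a b : YH d q n), T n (a * b) = T n (b * a)
  map_one : ∀ n : ℕ, T n 1 = 1
  markov : ∀ (n : ℕ) (a : YH d q (n + 1)),
    T (n + 2) (incl d q (n + 1) a * g d q n (Nat.lt_succ_self (n + 1))) = zVar d * T (n + 1) a
  framing : ∀ (n : ℕ) (a : YH d q n) (k : Fin (d - 1)),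
    T (n + 1) (incl d q n a * t d q (Fin.last n) ^ ((k : ℕ) + 1)) = xVar d k * T n a

open Classical in
/-- The Juyumaya trace `tr_d : ⋃ n, Y_{d,n}(q) → ℂ[z, x_1, …, x_{d-1}]`: the (unique) linear map
that satisfies the trace rules. -/
def tr (d : ℕ) (q : ℂ) : ∀ n : ℕ, YH d q n →ₗ[ℂ] TracePoly d :=
  if h : ∃ T : ∀ n : ℕ, YH d q n →ₗ[ℂ] TracePoly d, IsJuyumayaTrace d q T
  then h.choose else fun _ => 0

/-! ### The E-system and the specialized traces -/

/-- `E^{(m)} = (1/d) ∑_s x_{m+s} x_{d-s}`, with indices modulo `d`. -/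
def eSum (d : ℕ) [NeZero d] (x : ZMod d → ℂ) (m : ZMod d) : ℂ :=
  (1 / (d : ℂ)) * ∑ s : ZMod d, x (m + s) * x (-s)

/-- `x_1, …, x_{d-1}` (indexed modulo `d`, with `x_0 = 1`) is a solution of the E-system
`E^{(m)} = x_m E^{(0)}`, `1 ≤ m ≤ d - 1`. -/
def IsESolution (d : ℕ) [NeZero d] (x : ZMod d → ℂ) : Prop :=
  x 0 = 1 ∧ ∀ m : ZMod d, m ≠ 0 → eSum d x m = x m * eSum d x 0

/-- The solution `X_D` of the E-system parametrized by `D ⊆ ℤ/dℤ`: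
`x_k = (1/|D|) ∑_{m ∈ D} exp(2πi m k / d)`. -/
def eSolution (d : ℕ) [NeZero d] (D : Finset (ZMod d)) : ZMod d → ℂ := fun k =>
  (1 / (D.card : ℂ)) * ∑ m ∈ D, ZMod.stdAddChar (m * k)

lemma eSum_eSolution (d : ℕ) [NeZero d] (D : Finset (ZMod d)) (m : ZMod d) :
    eSum d (eSolution d D) m = (1 / (D.card : ℂ)) * eSolution d D m := by
  have hd : (d : ℂ) ≠ 0 := Nat.cast_ne_zero.mpr (NeZero.ne d)
  have key : ∀ a b : ZMod d, ∑ s : ZMod d,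
      ZMod.stdAddChar (a * (m + s)) * (ZMod.stdAddChar (b * (-s)) : ℂ) =
      if a = b then (d : ℂ) * ZMod.stdAddChar (a * m) else 0 := by
    intro a b
    have h1 : ∀ s : ZMod d, ZMod.stdAddChar (a * (m + s)) * (ZMod.stdAddChar (b * (-s)) : ℂ) =
        ZMod.stdAddChar (a * m) * ZMod.stdAddChar (s * (a - b)) := by
      intro s
      rw [← AddChar.map_add_eq_mul, ← AddChar.map_add_eq_mul]
      congr 1; ring
    simp_rw [h1]
    rw [← Finset.mul_sum,
      AddChar.sum_mulShift (a - b) (ZMod.isPrimitive_stdAddChar d)]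
    simp only [sub_eq_zero, ZMod.card]
    split_ifs <;> simp [mul_comm]
  have h2 : ∑ s : ZMod d, eSolution d D (m + s) * eSolution d D (-s) =
      (1 / (D.card : ℂ)) ^ 2 * ∑ a ∈ D, ∑ b ∈ D, ∑ s : ZMod d,
      ZMod.stdAddChar (a * (m + s)) * (ZMod.stdAddChar (b * (-s)) : ℂ) := by
    simp only [eSolution]
    rw [Finset.sum_congr rfl (fun a _ => Finset.sum_comm), Finset.sum_comm, Finset.mul_sum]
    refine Finset.sum_congr rfl fun s _ => ?_
    rw [← Finset.sum_mul_sum]; ring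
  rw [eSum, h2]
  simp only [key, Finset.sum_ite_eq, eSolution]
  rw [Finset.sum_congr rfl (fun a ha => if_pos ha), ← Finset.mul_sum]
  field_simp

lemma isESolution_eSolution (d : ℕ) [NeZero d] (D : Finset (ZMod d)) (hD : D.Nonempty) :
    IsESolution d (eSolution d D) := by
  have hc : (D.card : ℂ) ≠ 0 := Nat.cast_ne_zero.mpr hD.card_pos.ne'
  have h0 : eSolution d D 0 = 1 := by simp [eSolution, hc]
  refine ⟨h0, fun m _ => ?_⟩
  rw [eSum_eSolution, eSum_eSolution, h0]; ring

/-- The specialization `ℂ[z, x_1, …, x_{d-1}] → ℂ[z]` at complex values of `x_1, …, x_{d-1}`. -/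
def specialize (d : ℕ) (x : ZMod d → ℂ) : TracePoly d →ₐ[ℂ] Polynomial ℂ :=
  MvPolynomial.aeval fun o : Option (Fin (d - 1)) =>
    o.elim Polynomial.X fun k => Polynomial.C (x (((k : ℕ) + 1 : ℕ) : ZMod d))

/-- The trace `tr_d` with the parameters `x_1, …, x_{d-1}` specialized to complex numbers. -/
def specializedTr (d : ℕ) (q : ℂ) (x : ZMod d → ℂ) (n : ℕ) : YH d q n →ₗ[ℂ] Polynomial ℂ :=
  (specialize d x).toLinearMap.comp (tr d q n)

/-- The specialized trace `tr_{d,D}`. -/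
def trD (d : ℕ) [NeZero d] (q : ℂ) (D : Finset (ZMod d)) (n : ℕ) :
    YH d q n →ₗ[ℂ] Polynomial ℂ :=
  specializedTr d q (eSolution d D) n

/-- The framed braids in `F_n` that involve only the strands `a, …, b - 1`: the subgroup
generated by the `σ_i` and `t_j` on these strands. -/
def strandBlock (n a b : ℕ) : Subgroup (FramedBraidGroup n) :=
  Subgroup.closure ({w | ∃ (i : ℕ) (hi : i + 1 < n), a ≤ i ∧ i + 1 < b ∧ w = sigma i hi} ∪
    {w | ∃ j : Fin n, a ≤ (j : ℕ) ∧ (j : ℕ) < b ∧ w = framing j})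

end YokonumaHecke

end

/-! Two facts carry the theorem: every family of functionals obeying the Markov rules is
multiplicative on consecutive blocks of strands, and such a family exists, so that `tr` is a genuine
trace and not its default value 0.

Multiplicativity (`IsYokonumaSystem.trace_mul`) is an induction on the top strand of the right-hand
block. The algebra on strands k, …, l is spanned by elements x t_l^s and x g_{l-1} y with x, y on
the strands k, …, l-1 (`mem_span_strandCosets`). If a lives on strands below k and b is such an
element, the Markov rules together with cyclicity strip t_l^s or g_{l-1} from T(ab) and from T(b)
with the same factor, and b is replaced by an element on fewer strands. `braidToYH_mem` places the
image of a framed braid on a block in the corresponding subalgebra, and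
`IsJuyumayaTrace.map_braid_prod` iterates over the blocks.

Existence (`exists_isJuyumayaTrace`) comes from R-matrices. Letters carry a colour in ℤ/dℤ; t_j acts
diagonally through the colour of the j-th letter, and g_i acts by the Hecke R-matrix on two letters
of equal colour and by the flip on letters of different colours. Then e_i is the projector onto
equal colours, and the quadratic relation holds with parameter r = u - u⁻¹
(`isYokonumaSystem_braidMatrix`). With weight z u^{-1-2i} on the i-th letter of a colour, the
weighted trace obeys the Markov rules (`wordTrace_incl_mul_braidMatrix`, `sum_exch_letterWeight`).

Each model realizes only special parameters, so all of them are taken at once. By the same spanning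
theorem, traces of products of generators are polynomials in r, z and the colour weights y_χ
(`modelTrace_mem_range`), and these polynomials are determined by their values because the special
values are Zariski dense (`ModelParam.eq_zero_of_eval_point`). The resulting generic trace on the
group algebra is specialized at r = q - q⁻¹ and at the Fourier transform y_χ of the x_s, after which
it descends to the quotient (`exists_ringQuot_functional`). -/

noncomputable section

namespace YokonumaHecke

/-! ### Abstract Yokonuma–Hecke relations and the spanning theorem for strand algebras. -/

open Finset in
/-- Elements `g_i`, `t_j` (on `N` strands) of an algebra that satisfy the relations of the
framed braid group together with a quadratic relation of Yokonuma–Hecke type. -/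
structure IsYokonumaSystem {A B : Type*} [CommRing A] [Ring B] [Algebra A B]
    (d N : ℕ) (c : ℕ → ℕ → A) (g t : ℕ → B) : Prop where
  braid : ∀ i, i + 2 < N → g i * g (i + 1) * g i = g (i + 1) * g i * g (i + 1)
  comm : ∀ i j, i + 1 < j → j + 1 < N → g i * g j = g j * g i
  framing_comm : ∀ i j, i < N → j < N → t i * t j = t j * t i
  framing_left : ∀ i, i + 1 < N → t i * g i = g i * t (i + 1)
  framing_right : ∀ i, i + 1 < N → t (i + 1) * g i = g i * t i
  framing_far : ∀ i j, i + 1 < N → j < N → j ≠ i → j ≠ i + 1 → t j * g i = g i * t j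
  quad : ∀ i, i + 1 < N → g i * g i =
    1 + ∑ a ∈ range d, ∑ b ∈ range d, c a b • (t i ^ a * t (i + 1) ^ b * g i)

/-- The generators on the strands `k, …, l - 1`. -/
def strandGenerators {B : Type*} (g t : ℕ → B) (k l : ℕ) : Set B :=
  {x | ∃ i, k ≤ i ∧ i + 1 < l ∧ x = g i} ∪ {x | ∃ j, k ≤ j ∧ j < l ∧ x = t j}

/-- The subalgebra generated by the generators on the strands `k, …, l - 1`. -/
def strandAlgebra (A : Type*) {B : Type*} [CommRing A] [Ring B] [Algebra A B]
    (g t : ℕ → B) (k l : ℕ) : Subalgebra A B :=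
  Algebra.adjoin A (strandGenerators g t k l)

/-- The elements `x t_l^s` and `x g_{l-1} y`, with `x`, `y` on the strands `k, …, l - 1`. -/
def strandCosets (A : Type*) {B : Type*} [CommRing A] [Ring B] [Algebra A B]
    (g t : ℕ → B) (k l : ℕ) : Set B :=
  {w | ∃ x ∈ strandAlgebra A g t k l, ∃ s : ℕ, w = x * t l ^ s} ∪
  {w | ∃ i, k ≤ i ∧ i + 1 = l ∧ ∃ x ∈ strandAlgebra A g t k l,
    ∃ y ∈ strandAlgebra A g t k l, w = x * g i * y}

section

variable {A B : Type*} [CommRing A] [Ring B] [Algebra A B] {g t : ℕ → B}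

omit [Ring B] in
lemma strandGenerators_mono {k k' l l' : ℕ} (hk : k' ≤ k) (hl : l ≤ l') :
    strandGenerators g t k l ⊆ strandGenerators g t k' l' := by
  rintro x (⟨i, h1, h2, rfl⟩ | ⟨j, h1, h2, rfl⟩)
  · exact Or.inl ⟨i, hk.trans h1, h2.trans_le hl, rfl⟩
  · exact Or.inr ⟨j, hk.trans h1, h2.trans_le hl, rfl⟩

lemma strandAlgebra_mono {k k' l l' : ℕ} (hk : k' ≤ k) (hl : l ≤ l') :
    strandAlgebra A g t k l ≤ strandAlgebra A g t k' l' :=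
  Algebra.adjoin_mono (strandGenerators_mono hk hl)

lemma g_mem_strandAlgebra {k l i : ℕ} (h1 : k ≤ i) (h2 : i + 1 < l) :
    g i ∈ strandAlgebra A g t k l :=
  Algebra.subset_adjoin (Or.inl ⟨i, h1, h2, rfl⟩)

lemma t_mem_strandAlgebra {k l j : ℕ} (h1 : k ≤ j) (h2 : j < l) :
    t j ∈ strandAlgebra A g t k l :=
  Algebra.subset_adjoin (Or.inr ⟨j, h1, h2, rfl⟩)

lemma strandAlgebra_self (k : ℕ) : strandAlgebra A g t k k = ⊥ := by
  have h : strandGenerators g t k k = ∅ := by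
    ext x
    simp only [strandGenerators, Set.mem_union, Set.mem_ofPred_eq, Set.mem_empty_iff_false,
      iff_false]
    rintro (⟨i, h1, h2, -⟩ | ⟨i, h1, h2, -⟩) <;> omega
  rw [strandAlgebra, h, Algebra.adjoin_empty]

lemma map_strandAlgebra {B' : Type*} [Ring B'] [Algebra A B'] {g' t' : ℕ → B'}
    (f : B →ₐ[A] B') {k l : ℕ} (hg : ∀ i, i + 1 < l → f (g i) = g' i)
    (ht : ∀ j, j < l → f (t j) = t' j) :
    (strandAlgebra A g t k l).map f = strandAlgebra A g' t' k l := by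
  rw [strandAlgebra, AlgHom.map_adjoin, strandAlgebra]
  congr 1
  ext x
  constructor
  · rintro ⟨_, ⟨i, h1, h2, rfl⟩ | ⟨j, h1, h2, rfl⟩, rfl⟩
    · exact Or.inl ⟨i, h1, h2, hg i h2⟩
    · exact Or.inr ⟨j, h1, h2, ht j h2⟩
  · rintro (⟨i, h1, h2, rfl⟩ | ⟨j, h1, h2, rfl⟩)
    · exact ⟨_, Or.inl ⟨i, h1, h2, rfl⟩, hg i h2⟩
    · exact ⟨_, Or.inr ⟨j, h1, h2, rfl⟩, ht j h2⟩

lemma commute_of_mem_adjoin {S : Set B} {y : B} (h : ∀ x ∈ S, Commute x y) {x : B}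
    (hx : x ∈ Algebra.adjoin A S) : Commute x y := by
  induction hx using Algebra.adjoin_induction with
  | mem x hx => exact h x hx
  | algebraMap r => exact Algebra.commutes r y
  | add x x' _ _ h1 h2 => exact h1.add_left h2
  | mul x x' _ _ h1 h2 => exact h1.mul_left h2

namespace IsYokonumaSystem

variable {d N : ℕ} {c : ℕ → ℕ → A} (hs : IsYokonumaSystem d N c g t)
include hs

lemma commute_of_mem {k l l' : ℕ} (hl : l' ≤ N) {x y : B}
    (hx : x ∈ strandAlgebra A g t k l) (hy : y ∈ strandAlgebra A g t l l') : Commute x y := by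
  refine commute_of_mem_adjoin (fun x hx => (commute_of_mem_adjoin (fun y hy => ?_) hy).symm) hx
  rcases hx with ⟨i, -, h1, rfl⟩ | ⟨i, -, h1, rfl⟩ <;>
  rcases hy with ⟨j, h2, h3, rfl⟩ | ⟨j, h2, h3, rfl⟩
  · exact (hs.comm i j (by omega) (by omega)).symm
  · exact hs.framing_far i j (by omega) (by omega) (by omega) (by omega)
  · exact (hs.framing_far j i (by omega) (by omega) (by omega) (by omega)).symm
  · exact hs.framing_comm j i (by omega) (by omega)

lemma commute_t {k l : ℕ} (hl : l < N) {x : B} (hx : x ∈ strandAlgebra A g t k l) :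
    Commute x (t l) :=
  hs.commute_of_mem (l' := l + 1) hl hx (t_mem_strandAlgebra le_rfl (Nat.lt_succ_self l))

lemma commute_g {k l : ℕ} (hl : l + 1 < N) {x : B} (hx : x ∈ strandAlgebra A g t k l) :
    Commute x (g l) :=
  hs.commute_of_mem (l' := l + 2) hl hx (g_mem_strandAlgebra le_rfl (Nat.lt_succ_self _))

lemma t_pow_mul_g (i : ℕ) (hi : i + 1 < N) (s : ℕ) : t i ^ s * g i = g i * t (i + 1) ^ s := by
  have h : SemiconjBy (g i) (t (i + 1)) (t i) := (hs.framing_left i hi).symm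
  exact (h.pow_right s).eq.symm

lemma t_succ_pow_mul_g (i : ℕ) (hi : i + 1 < N) (s : ℕ) :
    t (i + 1) ^ s * g i = g i * t i ^ s := by
  have h : SemiconjBy (g i) (t i) (t (i + 1)) := (hs.framing_right i hi).symm
  exact (h.pow_right s).eq.symm

omit hs in
lemma strandAlgebra_mul_mem_span {k l : ℕ} {a b : B} (ha : a ∈ strandAlgebra A g t k l)
    (hb : b ∈ Submodule.span A (strandCosets A g t k l)) :
    a * b ∈ Submodule.span A (strandCosets A g t k l) := by
  induction hb using Submodule.span_induction with
  | mem b hb =>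
    refine Submodule.subset_span ?_
    rcases hb with ⟨x, hx, s, rfl⟩ | ⟨i, h1, h2, x, hx, y, hy, rfl⟩
    · exact Or.inl ⟨a * x, mul_mem ha hx, s, (mul_assoc _ _ _).symm⟩
    · exact Or.inr ⟨i, h1, h2, a * x, mul_mem ha hx, y, hy, by simp only [mul_assoc]⟩
  | zero => simp
  | add b b' _ _ h1 h2 => rw [mul_add]; exact add_mem h1 h2
  | smul r b _ h => rw [mul_smul_comm]; exact Submodule.smul_mem _ _ h

lemma t_mul_mem_span {k l : ℕ} (hl : l < N) {b : B}
    (hb : b ∈ Submodule.span A (strandCosets A g t k l)) :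
    t l * b ∈ Submodule.span A (strandCosets A g t k l) := by
  induction hb using Submodule.span_induction with
  | mem b hb =>
    refine Submodule.subset_span ?_
    rcases hb with ⟨x, hx, s, rfl⟩ | ⟨i, h1, rfl, x, hx, y, hy, rfl⟩
    · refine Or.inl ⟨x, hx, s + 1, ?_⟩
      rw [← mul_assoc, ← (hs.commute_t hl hx).eq, mul_assoc, pow_succ']
    · refine Or.inr ⟨i, h1, rfl, x, hx, t i * y,
        mul_mem (t_mem_strandAlgebra h1 (Nat.lt_succ_self i)) hy, ?_⟩
      rw [← mul_assoc, ← mul_assoc, ← (hs.commute_t hl hx).eq, mul_assoc x,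
        hs.framing_right i hl]
      simp only [mul_assoc]
  | zero => simp
  | add b b' _ _ h1 h2 => rw [mul_add]; exact add_mem h1 h2
  | smul r b _ h => rw [mul_smul_comm]; exact Submodule.smul_mem _ _ h

/-- This is the heart of the spanning theorem: two occurrences of the top generator merge into at
most one. Expanding x over the cosets one strand lower leaves either g_i² up to framings, reduced by
the quadratic relation, or g_i g_{i-1} g_i, reduced by the braid relation. -/
lemma g_mul_g_mem_span {k i : ℕ} (hk : k ≤ i) (hi : i + 1 < N) {x y : B}
    (hx : x ∈ Submodule.span A (strandCosets A g t k i))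
    (hy : y ∈ strandAlgebra A g t k (i + 1)) :
    g i * (x * g i * y) ∈ Submodule.span A (strandCosets A g t k (i + 1)) := by
  have hmono := strandAlgebra_mono (A := A) (g := g) (t := t) (le_refl k) (Nat.le_succ i)
  have hti : t i ∈ strandAlgebra A g t k (i + 1) := t_mem_strandAlgebra hk (Nat.lt_succ_self i)
  induction hx using Submodule.span_induction with
  | mem x hx =>
    rcases hx with ⟨x, hx, s, rfl⟩ | ⟨j, h1, rfl, x, hx, x', hx', rfl⟩
    -- Here x lies below strand i and commutes with g_i, while t_i^s passes through g_i as
    -- t_{i+1}^s; what remains is x g_i² t_{i+1}^s y, to be expanded by the quadratic relation.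
    · have e : g i * (x * t i ^ s * g i * y) = x * y * t (i + 1) ^ s +
          ∑ a ∈ Finset.range d, ∑ b ∈ Finset.range d,
            c a b • (x * t i ^ (a + s) * g i * (t i ^ b * y)) := by
        calc g i * (x * t i ^ s * g i * y)
            = (g i * x) * (t i ^ s * g i) * y := by simp only [mul_assoc]
          _ = x * (g i * g i) * (t (i + 1) ^ s * y) := by
              rw [hs.t_pow_mul_g i hi, ← (hs.commute_g hi hx).eq]; simp only [mul_assoc]
          _ = _ := by
              rw [hs.quad i hi, mul_add, add_mul, mul_one,
                ← ((hs.commute_t hi hy).pow_right s).eq, mul_assoc x y]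
              congr 1
              simp only [Finset.mul_sum, Finset.sum_mul]
              refine Finset.sum_congr rfl fun a _ => Finset.sum_congr rfl fun b _ => ?_
              rw [mul_smul_comm, smul_mul_assoc, ((hs.commute_t hi hy).pow_right s).eq]
              congr 1
              calc x * (t i ^ a * t (i + 1) ^ b * g i) * (t (i + 1) ^ s * y)
                  = x * t i ^ a * (t (i + 1) ^ b * (g i * t (i + 1) ^ s)) * y := by
                    simp only [mul_assoc]
                _ = x * t i ^ a * ((t (i + 1) ^ b * t i ^ s) * g i) * y := by
                    rw [← hs.t_pow_mul_g i hi]; simp only [mul_assoc]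
                _ = x * t i ^ a * (t i ^ s * (t (i + 1) ^ b * g i)) * y := by
                    have hc : Commute (t (i + 1)) (t i) :=
                      hs.framing_comm (i + 1) i hi (by omega)
                    rw [((hc.pow_left b).pow_right s).eq]; simp only [mul_assoc]
                _ = _ := by
                    rw [hs.t_succ_pow_mul_g i hi, pow_add]; simp only [mul_assoc]
      rw [e]
      refine add_mem (Submodule.subset_span (Or.inl ⟨_, mul_mem (hmono hx) hy, s, rfl⟩))
        (sum_mem fun a _ => sum_mem fun b _ => Submodule.smul_mem _ _
          (Submodule.subset_span (Or.inr ⟨i, hk, rfl, _, mul_mem (hmono hx) (pow_mem hti _), _,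
            mul_mem (pow_mem hti _) hy, rfl⟩)))
    -- Both x and x' commute with g_{j+1}, which exposes g_{j+1} g_j g_{j+1} = g_j g_{j+1} g_j, with
    -- a single top generator.
    · have hg : g j ∈ strandAlgebra A g t k (j + 1 + 1) :=
        g_mem_strandAlgebra h1 (Nat.lt_succ_self _)
      refine Submodule.subset_span (Or.inr ⟨j + 1, hk, rfl, x * g j, mul_mem (hmono hx) hg,
        g j * (x' * y), mul_mem hg (mul_mem (hmono hx') hy), ?_⟩)
      calc g (j + 1) * (x * g j * x' * g (j + 1) * y)
          = (g (j + 1) * x) * g j * (x' * g (j + 1)) * y := by simp only [mul_assoc]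
        _ = x * (g (j + 1) * g j * g (j + 1)) * x' * y := by
            rw [(hs.commute_g hi hx').eq, ← (hs.commute_g hi hx).eq]; simp only [mul_assoc]
        _ = _ := by rw [← hs.braid j hi]; simp only [mul_assoc]
  | zero => simp
  | add b b' _ _ h1 h2 => rw [add_mul, add_mul, mul_add]; exact add_mem h1 h2
  | smul r b _ h =>
    rw [smul_mul_assoc, smul_mul_assoc, mul_smul_comm]; exact Submodule.smul_mem _ _ h

lemma g_mul_mem_span {k i : ℕ} (hk : k ≤ i) (hi : i + 1 < N)
    (ih : ∀ x ∈ strandAlgebra A g t k (i + 1), x ∈ Submodule.span A (strandCosets A g t k i))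
    {b : B} (hb : b ∈ Submodule.span A (strandCosets A g t k (i + 1))) :
    g i * b ∈ Submodule.span A (strandCosets A g t k (i + 1)) := by
  induction hb using Submodule.span_induction with
  | mem b hb =>
    rcases hb with ⟨x, hx, s, rfl⟩ | ⟨j, h1, h2, x, hx, y, hy, rfl⟩
    · refine Submodule.subset_span (Or.inr ⟨i, hk, rfl, t i ^ s,
        pow_mem (t_mem_strandAlgebra hk (Nat.lt_succ_self i)) s, x, hx, ?_⟩)
      rw [((hs.commute_t hi hx).pow_right s).eq, ← mul_assoc, ← hs.t_pow_mul_g i hi]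
    · obtain rfl : j = i := by omega
      exact hs.g_mul_g_mem_span hk hi (ih x hx) hy
  | zero => simp
  | add b b' _ _ h1 h2 => rw [mul_add]; exact add_mem h1 h2
  | smul r b _ h => rw [mul_smul_comm]; exact Submodule.smul_mem _ _ h

-- The span contains 1, so stability under left multiplication by the generators forces it to
-- contain the whole algebra they generate.
omit hs in
lemma mem_span_of_generator_mul_mem {k l : ℕ}
    (h : ∀ x ∈ strandGenerators g t k (l + 1), ∀ m ∈ Submodule.span A (strandCosets A g t k l),
      x * m ∈ Submodule.span A (strandCosets A g t k l))
    {b : B} (hb : b ∈ strandAlgebra A g t k (l + 1)) :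
    b ∈ Submodule.span A (strandCosets A g t k l) := by
  suffices h : ∀ m ∈ Submodule.span A (strandCosets A g t k l),
      b * m ∈ Submodule.span A (strandCosets A g t k l) by
    simpa using h 1 (Submodule.subset_span (Or.inl ⟨1, one_mem _, 0, by simp⟩))
  induction hb using Algebra.adjoin_induction with
  | mem x hx => exact h x hx
  | algebraMap r => intro m hm; rw [← Algebra.smul_def]; exact Submodule.smul_mem _ _ hm
  | add x y _ _ h1 h2 => intro m hm; rw [add_mul]; exact add_mem (h1 m hm) (h2 m hm)
  | mul x y _ _ h1 h2 => intro m hm; rw [mul_assoc]; exact h1 _ (h2 m hm)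

/-- The algebra on the strands `k, …, l` is spanned by the `x t_l^s` and the `x g_{l-1} y`, with
`x`, `y` on the strands `k, …, l - 1`. -/
theorem mem_span_strandCosets (k l : ℕ) (hl : l < N) (b : B)
    (hb : b ∈ strandAlgebra A g t k (l + 1)) :
    b ∈ Submodule.span A (strandCosets A g t k l) := by
  induction l generalizing b with
  | zero =>
    refine mem_span_of_generator_mul_mem (fun x hx m hm => ?_) hb
    rcases hx with ⟨i, h1, h2, rfl⟩ | ⟨j, h1, h2, rfl⟩
    · omega
    · obtain rfl : j = 0 := by omega
      exact hs.t_mul_mem_span hl hm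
  | succ l ih =>
    refine mem_span_of_generator_mul_mem (fun x hx m hm => ?_) hb
    rcases hx with ⟨i, h1, h2, rfl⟩ | ⟨j, h1, h2, rfl⟩
    · by_cases h : i + 1 < l + 1
      · exact strandAlgebra_mul_mem_span (g_mem_strandAlgebra h1 h) hm
      · obtain rfl : i = l := by omega
        exact hs.g_mul_mem_span h1 hl (ih (by omega)) hm
    · by_cases h : j < l + 1
      · exact strandAlgebra_mul_mem_span (t_mem_strandAlgebra h1 h) hm
      · obtain rfl : j = l + 1 := by omega
        exact hs.t_mul_mem_span hl hm

/-! ### Multiplicativity of an abstract Markov trace. -/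

/-- A Markov trace is multiplicative on elements that involve disjoint consecutive sets of
strands. -/
theorem trace_mul {P : Type*} [CommRing P] [Algebra A P] (T : B →ₗ[A] P) (z : P) (X : ℕ → P)
    (hcomm : ∀ a b, T (a * b) = T (b * a)) (hone : T 1 = 1)
    (hz : ∀ i, i + 1 < N → ∀ x ∈ strandAlgebra A g t 0 (i + 1), T (x * g i) = z * T x)
    (hX : ∀ l, l < N → ∀ s, ∀ x ∈ strandAlgebra A g t 0 l, T (x * t l ^ s) = X s * T x)
    {k l : ℕ} (hkl : k ≤ l) (hl : l ≤ N) {a b : B} (ha : a ∈ strandAlgebra A g t 0 k)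
    (hb : b ∈ strandAlgebra A g t k l) : T (a * b) = T a * T b := by
  induction l, hkl using Nat.le_induction generalizing b with
  | base =>
    rw [strandAlgebra_self] at hb
    obtain ⟨r, rfl⟩ := Algebra.mem_bot.1 hb
    rw [← Algebra.commutes, ← Algebra.smul_def, map_smul, Algebra.algebraMap_eq_smul_one,
      map_smul, hone, mul_smul_comm, mul_one]
  | succ l hkl ih =>
    have hmk := strandAlgebra_mono (A := A) (g := g) (t := t) (Nat.zero_le k) (le_refl l)
    have hml := strandAlgebra_mono (A := A) (g := g) (t := t) (le_refl 0) hkl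
    have hb' := hs.mem_span_strandCosets k l hl b hb
    clear hb
    induction hb' using Submodule.span_induction with
    | mem b hb =>
      rcases hb with ⟨x, hx, s, rfl⟩ | ⟨i, h1, rfl, x, hx, y, hy, rfl⟩
      -- Both a x and x live below strand l, so t_l^s contributes the same factor X_s to T(ab) and
      -- to T(b).
      · rw [← mul_assoc, hX l hl s _ (mul_mem (hml ha) (hmk hx)), hX l hl s _ (hmk hx),
          ih (by omega) hx]
        ring
      -- Cyclicity brings g_i to the end, leaving y a x in front of it; a commutes with y because
      -- their strands are disjoint, so the induction hypothesis applies to a and y x.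
      · have e1 : T (a * (x * g i * y)) = z * T (a * (y * x)) := by
          rw [hcomm, show x * g i * y * a = x * (g i * (y * a)) by simp only [mul_assoc], hcomm,
            show g i * (y * a) * x = g i * (y * a * x) by simp only [mul_assoc], hcomm,
            hz i hl _ (mul_mem (mul_mem (hmk hy) (hml ha)) (hmk hx)),
            ← (hs.commute_of_mem (by omega) ha hy).eq, mul_assoc]
        have e2 : T (x * g i * y) = z * T (y * x) := by
          rw [hcomm, ← mul_assoc, hz i hl _ (mul_mem (hmk hy) (hmk hx))]
        rw [e1, e2, ih (by omega) (mul_mem hy hx)]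
        ring
    | zero => simp
    | add b b' _ _ h1 h2 => rw [mul_add, map_add, map_add, h1, h2, mul_add]
    | smul r b _ h => rw [mul_smul_comm, map_smul, map_smul, h, mul_smul_comm]

end IsYokonumaSystem

end

/-! ### The Yokonuma–Hecke algebra as an instance of the abstract relations. -/

section

variable (d : ℕ) (q : ℂ) (n : ℕ)

/-- `g_i` for an arbitrary natural number `i`, with value `0` outside the range. -/
def gNat (i : ℕ) : YH d q n := if h : i + 1 < n then g d q i h else 0

/-- `t_j` for an arbitrary natural number `j`, with value `0` outside the range. -/
def tNat (j : ℕ) : YH d q n := if h : j < n then t d q ⟨j, h⟩ else 0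

/-- The coefficients of the quadratic relation `g_i^2 = 1 + r e_i g_i`. -/
def quadCoeff {A : Type*} [CommRing A] [Algebra ℂ A] (d : ℕ) (r : A) (a b : ℕ) : A :=
  if d ∣ a + b then algebraMap ℂ A (1 / (d : ℂ)) * r else 0

variable {d q n}

lemma gNat_of_lt {i : ℕ} (h : i + 1 < n) : gNat d q n i = g d q i h := dif_pos h

lemma tNat_of_lt {j : ℕ} (h : j < n) : tNat d q n j = t d q ⟨j, h⟩ := dif_pos h

lemma mframing_pow (j : Fin n) : mframing d j ^ d = 1 := by
  have h := PresentedGroup.one_of_mem (rels := {w | ModularRel d n w}) (ModularRel.modular j)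
  simpa [wordFraming, mframing, PresentedGroup.of] using h

lemma of_framedRel {u v : FreeGroup (Gen n)} (h : FramedRel n (u * v⁻¹)) :
    PresentedGroup.mk {w | ModularRel d n w} u = PresentedGroup.mk {w | ModularRel d n w} v := by
  have h := PresentedGroup.one_of_mem (rels := {w | ModularRel d n w}) (ModularRel.framed _ h)
  rwa [map_mul, map_inv, mul_inv_eq_one] at h

lemma msigma_braid (i : ℕ) (hi : i + 1 < n) (hj : i + 1 + 1 < n) :
    msigma d i hi * msigma d (i + 1) hj * msigma d i hi =
      msigma d (i + 1) hj * msigma d i hi * msigma d (i + 1) hj := by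
  simpa [wordSigma, msigma, PresentedGroup.of] using
    of_framedRel (d := d) (FramedRel.braid i hi hj)

lemma msigma_comm (i j : ℕ) (hi : i + 1 < n) (hj : j + 1 < n) (hij : i + 1 < j) :
    msigma d i hi * msigma d j hj = msigma d j hj * msigma d i hi := by
  simpa [wordSigma, msigma, PresentedGroup.of] using
    of_framedRel (d := d) (FramedRel.comm i j hi hj hij)

lemma mframing_comm (i j : Fin n) : mframing d i * mframing d j = mframing d j * mframing d i := by
  simpa [wordFraming, mframing, PresentedGroup.of] using
    of_framedRel (d := d) (FramedRel.framing_comm i j)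

lemma mframing_msigma (i : ℕ) (hi : i + 1 < n) (j : Fin n) :
    mframing d j * msigma d i hi = msigma d i hi * mframing d (strandSwap i hi j) := by
  simpa [wordSigma, wordFraming, msigma, mframing, PresentedGroup.of] using
    of_framedRel (d := d) (FramedRel.framing_sigma i hi j)

lemma t_pow_d (j : Fin n) : t d q j ^ d = 1 := by
  rw [t, ← map_pow, ← map_pow, mframing_pow, map_one, map_one]

lemma g_sq (i : ℕ) (hi : i + 1 < n) :
    g d q i hi ^ 2 = 1 + (q - q⁻¹) • (toYH d q n (idem d i hi) * g d q i hi) := by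
  have h := RingQuot.mkAlgHom_rel ℂ (QuadRel.quad (d := d) (q := q) (n := n) i hi)
  simp only [map_pow, map_add, map_one, map_smul, map_mul] at h
  exact h

/-- For each a < d exactly one b < d satisfies d ∣ a + b, namely (d - a) mod d. The double sum is
thus r e_i with inverses rewritten as nonnegative powers, a form that makes sense in any algebra. -/
lemma sum_range_quadCoeff [NeZero d] {A B : Type*} [CommRing A] [Ring B] [Algebra ℂ A]
    [Algebra A B] [Algebra ℂ B] [IsScalarTower ℂ A B] (r : A) (x y : B) :
    ∑ a ∈ Finset.range d, ∑ b ∈ Finset.range d, quadCoeff d r a b • (x ^ a * y ^ b) =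
      r • ((1 / (d : ℂ)) • ∑ s ∈ Finset.range d, x ^ s * y ^ ((d - s) % d)) := by
  have hd : 0 < d := Nat.pos_of_ne_zero (NeZero.ne d)
  simp only [Finset.smul_sum]
  refine Finset.sum_congr rfl fun a ha => ?_
  rw [Finset.mem_range] at ha
  have key : ∀ b ∈ Finset.range d, d ∣ a + b ↔ b = (d - a) % d := by
    intro b hb
    rw [Finset.mem_range] at hb
    rcases Nat.eq_zero_or_pos a with rfl | ha'
    · simp only [zero_add, Nat.sub_zero, Nat.mod_self]
      exact ⟨fun h => Nat.eq_zero_of_dvd_of_lt h hb, fun h => h ▸ dvd_zero d⟩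
    · rw [Nat.mod_eq_of_lt (by omega : d - a < d)]
      constructor
      · rintro ⟨k, hk⟩
        have : k = 1 := by
          rcases k with _ | _ | k
          · omega
          · rfl
          · nlinarith
        subst this; omega
      · rintro rfl
        exact ⟨1, by omega⟩
  rw [Finset.sum_eq_single ((d - a) % d)]
  · rw [quadCoeff, if_pos ((key _ (Finset.mem_range.2 (Nat.mod_lt _ hd))).2 rfl), mul_smul,
      algebraMap_smul, smul_comm]
  · intro b hb hne
    rw [quadCoeff, if_neg (fun h => hne ((key b hb).1 h)), zero_smul]
  · intro h; exact absurd (Finset.mem_range.2 (Nat.mod_lt _ hd)) h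

lemma sum_range_quadCoeff_mul [NeZero d] {A B : Type*} [CommRing A] [Ring B] [Algebra ℂ A]
    [Algebra A B] [Algebra ℂ B] [IsScalarTower ℂ A B] (r : A) (x y w : B) :
    ∑ a ∈ Finset.range d, ∑ b ∈ Finset.range d, quadCoeff d r a b • (x ^ a * y ^ b * w) =
      r • (((1 / (d : ℂ)) • ∑ s ∈ Finset.range d, x ^ s * y ^ ((d - s) % d)) * w) := by
  rw [← smul_mul_assoc, ← sum_range_quadCoeff]
  simp only [Finset.sum_mul, smul_mul_assoc]

lemma sum_Icc_pow_mul_inv_pow [NeZero d] {G : Type*} [Group G] {M : Type*} [AddCommMonoid M]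
    (f : G → M) (x y : G) (hx : x ^ d = 1) (hy : y ^ d = 1) :
    ∑ s ∈ Finset.Icc 1 d, f (x ^ s * (y ^ s)⁻¹) =
      ∑ s ∈ Finset.range d, f (x ^ s * y ^ ((d - s) % d)) := by
  have hd : 0 < d := Nat.pos_of_ne_zero (NeZero.ne d)
  have e : ∀ s ≤ d, (y ^ s)⁻¹ = y ^ ((d - s) % d) := by
    intro s hs
    have h2 : y ^ ((d - s) % d) = y ^ (d - s) := by
      conv_rhs => rw [← Nat.div_add_mod (d - s) d, pow_add, pow_mul, hy, one_pow, one_mul]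
    rw [h2, inv_eq_iff_mul_eq_one, ← pow_add, Nat.add_sub_cancel' hs, hy]
  have h1 : ∑ s ∈ Finset.Icc 1 d, f (x ^ s * (y ^ s)⁻¹) =
      ∑ s ∈ Finset.range d, f (x ^ s * (y ^ s)⁻¹) := by
    -- The two ranges differ in the terms s = d and s = 0, which agree because both d-th powers are
    -- 1.
    rw [Finset.range_eq_Ico, ← Finset.sum_Ico_add_eq_sum_Icc (by omega : 1 ≤ d),
      Finset.sum_eq_sum_Ico_succ_bot hd, hx, hy]
    simp [add_comm]
  rw [h1]
  exact Finset.sum_congr rfl fun s hs => by rw [e s (Finset.mem_range.1 hs).le]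

lemma idem_eq [NeZero d] (i : ℕ) (hi : i + 1 < n) :
    idem d i hi = (1 / (d : ℂ)) • ∑ s ∈ Finset.range d,
      MonoidAlgebra.of ℂ (ModularFramedBraidGroup d n)
        (mframing d ⟨i, Nat.lt_of_succ_lt hi⟩ ^ s * mframing d ⟨i + 1, hi⟩ ^ ((d - s) % d)) := by
  rw [idem, sum_Icc_pow_mul_inv_pow _ _ _ (mframing_pow _) (mframing_pow _)]

lemma toYH_idem [NeZero d] (i : ℕ) (hi : i + 1 < n) :
    toYH d q n (idem d i hi) = (1 / (d : ℂ)) • ∑ s ∈ Finset.range d,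
      t d q ⟨i, Nat.lt_of_succ_lt hi⟩ ^ s * t d q ⟨i + 1, hi⟩ ^ ((d - s) % d) := by
  rw [idem_eq]
  simp only [map_smul, map_sum, map_mul, map_pow, t]

lemma strandSwap_left (i : ℕ) (hi : i + 1 < n) :
    strandSwap i hi ⟨i, Nat.lt_of_succ_lt hi⟩ = ⟨i + 1, hi⟩ := Equiv.swap_apply_left _ _

lemma strandSwap_right (i : ℕ) (hi : i + 1 < n) :
    strandSwap i hi ⟨i + 1, hi⟩ = ⟨i, Nat.lt_of_succ_lt hi⟩ := Equiv.swap_apply_right _ _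

lemma strandSwap_of_ne (i : ℕ) (hi : i + 1 < n) (j : Fin n) (h1 : (j : ℕ) ≠ i)
    (h2 : (j : ℕ) ≠ i + 1) : strandSwap i hi j = j :=
  Equiv.swap_apply_of_ne_of_ne (fun h => h1 (congrArg Fin.val h)) (fun h => h2 (congrArg Fin.val h))

lemma t_mul_g (i : ℕ) (hi : i + 1 < n) (j : Fin n) :
    t d q j * g d q i hi = g d q i hi * t d q (strandSwap i hi j) := by
  simp only [t, g, ← map_mul, mframing_msigma]

theorem isYokonumaSystem_YH [NeZero d] :
    IsYokonumaSystem d n (quadCoeff d (q - q⁻¹)) (gNat d q n) (tNat d q n) where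
  braid i hi := by
    rw [gNat_of_lt hi, gNat_of_lt (by omega : i + 1 < n)]
    simp only [g, ← map_mul, msigma_braid]
  comm i j hij hj := by
    rw [gNat_of_lt hj, gNat_of_lt (by omega : i + 1 < n)]
    simp only [g, ← map_mul, msigma_comm i j _ hj hij]
  framing_comm i j hi hj := by
    rw [tNat_of_lt hi, tNat_of_lt hj]
    simp only [t, ← map_mul, mframing_comm]
  framing_left i hi := by
    rw [gNat_of_lt hi, tNat_of_lt hi, tNat_of_lt (Nat.lt_of_succ_lt hi), t_mul_g, strandSwap_left]
  framing_right i hi := by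
    rw [gNat_of_lt hi, tNat_of_lt hi, tNat_of_lt (Nat.lt_of_succ_lt hi), t_mul_g, strandSwap_right]
  framing_far i j hi hj h1 h2 := by
    rw [gNat_of_lt hi, tNat_of_lt hj, t_mul_g, strandSwap_of_ne _ _ _ h1 h2]
  quad i hi := by
    rw [sum_range_quadCoeff_mul, gNat_of_lt hi, tNat_of_lt hi, tNat_of_lt (Nat.lt_of_succ_lt hi),
      ← toYH_idem, ← sq, g_sq]

lemma incl_gNat {i : ℕ} (hi : i + 1 < n) : incl d q n (gNat d q n i) = gNat d q (n + 1) i := by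
  rw [gNat_of_lt hi, gNat_of_lt (Nat.lt_succ_of_lt hi), incl_g]

lemma incl_tNat {j : ℕ} (hj : j < n) : incl d q n (tNat d q n j) = tNat d q (n + 1) j := by
  rw [tNat_of_lt hj, tNat_of_lt (Nat.lt_succ_of_lt hj), incl_t]; rfl

/-- The inclusion maps generators to generators, so it is onto the algebra of the lower strands.
Only preimages are needed; injectivity of `incl` plays no role. -/
lemma exists_incl_eq {l : ℕ} (hl : l ≤ n) {x : YH d q (n + 1)}
    (hx : x ∈ strandAlgebra ℂ (gNat d q (n + 1)) (tNat d q (n + 1)) 0 l) :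
    ∃ y ∈ strandAlgebra ℂ (gNat d q n) (tNat d q n) 0 l, incl d q n y = x := by
  rw [← map_strandAlgebra (incl d q n) (fun i hi => incl_gNat (by omega))
    (fun j hj => incl_tNat (by omega))] at hx
  exact hx

/-! ### Markov rules at an arbitrary strand, and multiplicativity of the Juyumaya trace. -/

namespace IsJuyumayaTrace

variable {T : ∀ n : ℕ, YH d q n →ₗ[ℂ] TracePoly d} (hT : IsJuyumayaTrace d q T)
include hT

/-- The defining rule treats only the last generator. Compatibility with `incl` discards the strands
to the right until g_i is the last one. -/
lemma map_mul_g {i : ℕ} (hi : i + 1 < n) (x : YH d q n)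
    (hx : x ∈ strandAlgebra ℂ (gNat d q n) (tNat d q n) 0 (i + 1)) :
    T n (x * gNat d q n i) = zVar d * T n x := by
  induction n with
  | zero => omega
  | succ n ih =>
    obtain ⟨y, hy, rfl⟩ := exists_incl_eq (by omega) hx
    rcases Nat.lt_or_ge (i + 1) n with h | h
    · rw [← incl_gNat h, ← map_mul, hT.map_incl, hT.map_incl, ih h y hy]
    · obtain rfl : n = i + 1 := by omega
      rw [gNat_of_lt hi, hT.map_incl]
      exact hT.markov i y

lemma map_mul_t_pow [NeZero d] : ∃ X : ℕ → TracePoly d, ∀ n l : ℕ, l < n → ∀ s : ℕ, ∀ x : YH d q n,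
    x ∈ strandAlgebra ℂ (gNat d q n) (tNat d q n) 0 l →
      T n (x * tNat d q n l ^ s) = X s * T n x := by
  have hd : 0 < d := Nat.pos_of_ne_zero (NeZero.ne d)
  -- Since t^d = 1, only s mod d matters; residue 0 gives x_0 = 1, and the shift by one matches the
  -- indexing of x_1, …, x_{d-1} from 0.
  refine ⟨fun s => if h : s % d = 0 then 1 else xVar d ⟨s % d - 1, by
    have := Nat.mod_lt s hd; omega⟩, fun n l hl s x hx => ?_⟩
  induction n with
  | zero => omega
  | succ n ih =>
    obtain ⟨y, hy, rfl⟩ := exists_incl_eq (by omega) hx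
    rcases Nat.lt_or_ge l n with h | h
    · rw [← incl_tNat h, ← map_pow, ← map_mul, hT.map_incl, hT.map_incl, ih h y hy]
    · obtain rfl : n = l := by omega
      have e : tNat d q (n + 1) n ^ s = tNat d q (n + 1) n ^ (s % d) := by
        rw [tNat_of_lt hl]
        conv_lhs => rw [← Nat.div_add_mod s d, pow_add, pow_mul, t_pow_d, one_pow, one_mul]
      rw [e, hT.map_incl]
      beta_reduce
      split_ifs with h0
      · rw [h0, pow_zero, mul_one, one_mul, hT.map_incl]
      · have hk := hT.framing n y ⟨s % d - 1, by have := Nat.mod_lt s hd; omega⟩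
        rw [Nat.sub_add_cancel (Nat.pos_of_ne_zero h0)] at hk
        rw [tNat_of_lt hl]
        exact hk

theorem map_mul [NeZero d] {k l : ℕ} (hkl : k ≤ l) (hl : l ≤ n) {a b : YH d q n}
    (ha : a ∈ strandAlgebra ℂ (gNat d q n) (tNat d q n) 0 k)
    (hb : b ∈ strandAlgebra ℂ (gNat d q n) (tNat d q n) k l) : T n (a * b) = T n a * T n b := by
  obtain ⟨X, hX⟩ := hT.map_mul_t_pow
  exact isYokonumaSystem_YH.trace_mul (T n) (zVar d) X (hT.map_mul_comm n) (hT.map_one n)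
    (fun i hi x hx => hT.map_mul_g hi x hx) (fun l hl s x hx => hX n l hl s x hx) hkl hl ha hb

end IsJuyumayaTrace

/-! ### Framed braids on a block of strands. -/

lemma g_inv_mul (i : ℕ) (hi : i + 1 < n) :
    (g d q i hi - (q - q⁻¹) • toYH d q n (idem d i hi)) * g d q i hi = 1 := by
  rw [sub_mul, ← sq, g_sq, smul_mul_assoc, add_sub_cancel_right]

/-- A subalgebra need not be closed under inverses, so w and w⁻¹ are treated together. On
generators, g_i⁻¹ = g_i - (q - q⁻¹) e_i and t_j⁻¹ = t_j^{d-1}, which involve no further strands. -/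
lemma braidToYH_mem [NeZero d] {a b : ℕ} {w : FramedBraidGroup n} (hw : w ∈ strandBlock n a b) :
    braidToYH d q n w ∈ strandAlgebra ℂ (gNat d q n) (tNat d q n) a b := by
  suffices h : braidToYH d q n w ∈ strandAlgebra ℂ (gNat d q n) (tNat d q n) a b ∧
      braidToYH d q n w⁻¹ ∈ strandAlgebra ℂ (gNat d q n) (tNat d q n) a b from h.1
  have hd : 0 < d := Nat.pos_of_ne_zero (NeZero.ne d)
  have ht : ∀ j : Fin n, a ≤ j → (j : ℕ) < b →
      t d q j ∈ strandAlgebra ℂ (gNat d q n) (tNat d q n) a b := fun j h1 h2 => by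
    simpa only [tNat_of_lt j.2] using
      t_mem_strandAlgebra (A := ℂ) (g := gNat d q n) (t := tNat d q n) h1 h2
  induction hw using Subgroup.closure_induction with
  | mem w hw =>
    rcases hw with ⟨i, hi, h1, h2, rfl⟩ | ⟨j, h1, h2, rfl⟩
    · have hg : g d q i hi ∈ strandAlgebra ℂ (gNat d q n) (tNat d q n) a b := by
        simpa only [gNat_of_lt hi] using
          g_mem_strandAlgebra (A := ℂ) (g := gNat d q n) (t := tNat d q n) h1 h2
      refine ⟨by rwa [braidToYH_sigma], ?_⟩
      have e : braidToYH d q n (sigma i hi)⁻¹ =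
          g d q i hi - (q - q⁻¹) • toYH d q n (idem d i hi) := by
        refine (left_inv_eq_right_inv (g_inv_mul i hi) ?_).symm
        rw [← braidToYH_sigma, ← _root_.map_mul, mul_inv_cancel, _root_.map_one]
      rw [e, toYH_idem]
      exact sub_mem hg (Subalgebra.smul_mem _ (Subalgebra.smul_mem _ (sum_mem fun s _ =>
        mul_mem (pow_mem (ht _ h1 (Nat.lt_of_succ_lt h2)) _)
          (pow_mem (ht _ (Nat.le_succ_of_le h1) h2) _)) _) _)
    · refine ⟨by rw [braidToYH_framing]; exact ht j h1 h2, ?_⟩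
      have e : braidToYH d q n (framing j)⁻¹ = t d q j ^ (d - 1) := by
        refine (left_inv_eq_right_inv (?_ : t d q j ^ (d - 1) * t d q j = 1) ?_).symm
        · rw [← pow_succ, Nat.sub_add_cancel hd, t_pow_d]
        · rw [← braidToYH_framing, ← _root_.map_mul, mul_inv_cancel, _root_.map_one]
      rw [e]
      exact pow_mem (ht j h1 h2) _
  | one => simp [one_mem]
  | mul x y _ _ h1 h2 =>
    rw [mul_inv_rev, _root_.map_mul, _root_.map_mul]
    exact ⟨mul_mem h1.1 h2.1, mul_mem h2.2 h1.2⟩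
  | inv x _ h => rw [inv_inv]; exact h.symm

/-- A Markov trace of a product of framed braids on disjoint consecutive sets of strands. -/
theorem IsJuyumayaTrace.map_braid_prod [NeZero d] {T : ∀ n : ℕ, YH d q n →ₗ[ℂ] TracePoly d}
    (hT : IsJuyumayaTrace d q T) {m : ℕ} (c : Fin (m + 1) → ℕ) (hc : Monotone c)
    (hcn : c (Fin.last m) ≤ n) (α : Fin m → FramedBraidGroup n)
    (hα : ∀ j : Fin m, α j ∈ strandBlock n (c j.castSucc) (c j.succ)) :
    braidToYH d q n (List.ofFn α).prod ∈
        strandAlgebra ℂ (gNat d q n) (tNat d q n) 0 (c (Fin.last m)) ∧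
      T n (braidToYH d q n (List.ofFn α).prod) = ∏ j : Fin m, T n (braidToYH d q n (α j)) := by
  induction m with
  | zero => simp [one_mem, hT.map_one]
  | succ m ih =>
    have hle : c (Fin.last m).castSucc ≤ c (Fin.last (m + 1)) := hc (Fin.le_last _)
    obtain ⟨h1, h2⟩ := ih (c ∘ Fin.castSucc) (hc.comp Fin.strictMono_castSucc.monotone)
      (hle.trans hcn) (fun j => α j.castSucc) (fun j => hα j.castSucc)
    have h3 := braidToYH_mem (d := d) (q := q) (hα (Fin.last m))
    simp only [List.ofFn_succ', List.concat_eq_append, List.prod_append, List.prod_singleton,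
      _root_.map_mul, Fin.prod_univ_castSucc]
    refine ⟨mul_mem (strandAlgebra_mono le_rfl hle h1)
      (strandAlgebra_mono (Nat.zero_le _) le_rfl h3), ?_⟩
    rw [hT.map_mul hle hcn h1 h3, h2]

end

/-! ### Diagonal-framing R-matrix models -/

/-- Letters of colour `χ ∈ ℤ/dℤ`, where there are `N χ` letters of colour `χ`. -/
abbrev Letter {d : ℕ} (N : ZMod d → ℕ) : Type := (χ : ZMod d) × Fin (N χ)

section

variable {d : ℕ} {N : ZMod d → ℕ} {A K : Type*} [CommRing A] [CommRing K] [Algebra A K]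

lemma Letter.ext_iff' (x y : Letter N) : x = y ↔ x.1 = y.1 ∧ (x.2 : ℕ) = y.2 := by
  constructor
  · rintro rfl; exact ⟨rfl, rfl⟩
  · obtain ⟨χ, i⟩ := x
    obtain ⟨χ', j⟩ := y
    rintro ⟨h1, h2⟩
    dsimp only at h1 h2
    subst h1
    rw [Fin.ext h2]

/-- The coefficient of the identity in the R-matrix that acts on the pair of letters `x`, `y`. -/
def exch (u c : K) (x y : Letter N) : K :=
  if x = y then u - 1 else if x.1 = y.1 ∧ (y.2 : ℕ) < x.2 then c else 0

lemma exch_self (u c : K) (x : Letter N) : exch u c x x = u - 1 := if_pos rfl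

lemma exch_of_ne (u c : K) {x y : Letter N} (h : x ≠ y) :
    exch u c x y = if x.1 = y.1 ∧ (y.2 : ℕ) < x.2 then c else 0 := if_neg h

/-- The quadratic relation read on one row, where f₀ and f₁ are the entries at a word and at its
swap. For distinct letters of equal colour exactly one of the two coefficients is c and the other is
0; for equal letters the claim is u² = 1 + c u; for different colours both coefficients vanish. -/
lemma exch_quad {u c : K} (hu : u * u = 1 + c * u) (p q : Letter N) (f₀ f₁ : K)
    (hpq : p = q → f₁ = f₀) :
    f₀ + exch u c q p * f₁ + exch u c p q * (f₁ + exch u c p q * f₀) =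
      f₀ + c * ((if p.1 = q.1 then 1 else 0) * (f₁ + exch u c p q * f₀)) := by
  by_cases h : p = q
  · subst h
    rw [hpq rfl, exch_self, if_pos rfl]
    linear_combination f₀ * hu
  · rw [exch_of_ne u c h, exch_of_ne u c (Ne.symm h)]
    rw [Letter.ext_iff', not_and_or] at h
    by_cases hc : p.1 = q.1
    · have h' : (p.2 : ℕ) ≠ q.2 := h.resolve_left (not_not.2 hc)
      rcases Nat.lt_or_gt_of_ne h' with h1 | h1
      · simp [hc, h1, not_lt.2 h1.le]
      · simp [hc, h1, not_lt.2 h1.le]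
    · simp [hc, Ne.symm hc]

/-- The braid relation read on one row, after cancelling the terms common to both sides. It is a
case check on the coincidences and the order of three letters; u² = 1 + c u enters only when p = q ≠
r or q = r ≠ p. -/
lemma exch_braid {u c : K} (hu : u * u = 1 + c * u) (p q r : Letter N) (f₀ f₁ f₂ : K)
    (hpq : p = q → f₁ = f₀) (hqr : q = r → f₂ = f₀) :
    (exch u c p r * exch u c q p + exch u c p q * exch u c q r - exch u c q r * exch u c p r) * f₁ +
    (exch u c p q * exch u c p r - exch u c p r * exch u c r q - exch u c q r * exch u c p q) * f₂ +
    (exch u c p q ^ 2 * exch u c q r - exch u c q r ^ 2 * exch u c p q) * f₀ = 0 := by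
  by_cases h1 : p = q
  · subst h1
    rw [hpq rfl, exch_self]
    by_cases h2 : p = r
    · subst h2
      rw [hqr rfl, exch_self]; ring
    · rw [exch_of_ne u c h2, exch_of_ne u c (Ne.symm h2)]
      rw [Letter.ext_iff'] at h2
      split_ifs <;> first | (exfalso; omega) | linear_combination c * f₀ * hu | ring
  · by_cases h2 : q = r
    · subst h2
      rw [hqr rfl, exch_self, exch_of_ne u c h1, exch_of_ne u c (Ne.symm h1)]
      rw [Letter.ext_iff'] at h1
      split_ifs <;> first | (exfalso; omega) | linear_combination (-c * f₀) * hu | ring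
    · by_cases h3 : p = r
      · subst h3
        rw [exch_self, exch_of_ne u c h1, exch_of_ne u c h2]
        rw [Letter.ext_iff'] at h1 h2
        split_ifs <;> first | (exfalso; omega) | ring
      · rw [exch_of_ne u c h1, exch_of_ne u c h2, exch_of_ne u c h3,
          exch_of_ne u c (Ne.symm h1), exch_of_ne u c (Ne.symm h2)]
        rw [Letter.ext_iff'] at h1 h2 h3
        split_ifs <;> first | (exfalso; grind) | ring
end

/-! ### Operators on words: the R-matrices and colour operators satisfy the relations. -/

section

open Matrix

set_option linter.unusedSectionVars false

variable {d : ℕ} [NeZero d] {N : ZMod d → ℕ} {A K : Type*} [CommRing A] [CommRing K]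
  [Algebra A K] {n : ℕ}

/-- Words of length `n`. -/
abbrev Word (N : ZMod d → ℕ) (n : ℕ) : Type := Fin n → Letter N

/-- The operators on words. -/
abbrev WordMatrix (N : ZMod d → ℕ) (K : Type*) (n : ℕ) : Type _ := Matrix (Word N n) (Word N n) K

/-- The R-matrix acting on the letters `i` and `i + 1`. -/
def braidMatrix (u c : K) (i : ℕ) (hi : i + 1 < n) : WordMatrix N K n := fun w v =>
  (if v = w ∘ strandSwap i hi then 1 else 0) +
    if v = w then exch u c (w ⟨i, Nat.lt_of_succ_lt hi⟩) (w ⟨i + 1, hi⟩) else 0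

/-- The diagonal operator that multiplies a word by `κ` of the colour of the letter `j`. -/
def colourMatrix (κ : ZMod d → K) (j : Fin n) : WordMatrix N K n :=
  diagonal fun w => κ (w j).1

/-- Left multiplication mixes only the rows w and w ∘ s_i. This turns every operator identity below
into a scalar identity in a few entries of an arbitrary matrix M. -/
lemma braidMatrix_mul_apply (u c : K) (i : ℕ) (hi : i + 1 < n) (M : WordMatrix N K n)
    (w v : Word N n) : (braidMatrix u c i hi * M : WordMatrix N K n) w v = M (w ∘ strandSwap i hi) v +
      exch u c (w ⟨i, Nat.lt_of_succ_lt hi⟩) (w ⟨i + 1, hi⟩) * M w v := by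
  simp [Matrix.mul_apply, braidMatrix, add_mul, Finset.sum_add_distrib]

lemma colourMatrix_mul_apply (κ : ZMod d → K) (j : Fin n) (M : WordMatrix N K n)
    (w v : Word N n) : (colourMatrix κ j * M : WordMatrix N K n) w v = κ (w j).1 * M w v := by
  simp [colourMatrix, diagonal_mul]

lemma comp_strandSwap_left (i : ℕ) (hi : i + 1 < n) (w : Word N n) :
    (w ∘ strandSwap i hi) ⟨i, Nat.lt_of_succ_lt hi⟩ = w ⟨i + 1, hi⟩ := by
  rw [Function.comp_apply, strandSwap_left]

lemma comp_strandSwap_right (i : ℕ) (hi : i + 1 < n) (w : Word N n) :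
    (w ∘ strandSwap i hi) ⟨i + 1, hi⟩ = w ⟨i, Nat.lt_of_succ_lt hi⟩ := by
  rw [Function.comp_apply, strandSwap_right]

lemma comp_strandSwap_of_ne (i : ℕ) (hi : i + 1 < n) (w : Word N n) (j : Fin n)
    (h1 : (j : ℕ) ≠ i) (h2 : (j : ℕ) ≠ i + 1) : (w ∘ strandSwap i hi) j = w j := by
  rw [Function.comp_apply, strandSwap_of_ne _ _ _ h1 h2]

lemma strandSwap_strandSwap (i : ℕ) (hi : i + 1 < n) (j : Fin n) :
    strandSwap i hi (strandSwap i hi j) = j := Equiv.swap_apply_self _ _ _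

lemma comp_strandSwap_self (i : ℕ) (hi : i + 1 < n) (w : Word N n) :
    (w ∘ strandSwap i hi) ∘ strandSwap i hi = w := by
  funext j; simp only [Function.comp_apply, strandSwap_strandSwap]

lemma comp_strandSwap_eq (i : ℕ) (hi : i + 1 < n) (w : Word N n)
    (h : w ⟨i, Nat.lt_of_succ_lt hi⟩ = w ⟨i + 1, hi⟩) : w ∘ strandSwap i hi = w := by
  funext j
  by_cases h1 : (j : ℕ) = i
  · obtain rfl : j = ⟨i, Nat.lt_of_succ_lt hi⟩ := Fin.ext h1
    rw [comp_strandSwap_left, h]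
  · by_cases h2 : (j : ℕ) = i + 1
    · obtain rfl : j = ⟨i + 1, hi⟩ := Fin.ext h2
      rw [comp_strandSwap_right, h]
    · exact comp_strandSwap_of_ne _ _ _ _ h1 h2

lemma comp_strandSwap_comm (i j : ℕ) (hi : i + 1 < n) (hj : j + 1 < n) (hij : i + 1 < j)
    (w : Word N n) : (w ∘ strandSwap i hi) ∘ strandSwap j hj =
      (w ∘ strandSwap j hj) ∘ strandSwap i hi := by
  funext k
  simp only [Function.comp_apply, strandSwap, Equiv.swap_apply_def, Fin.ext_iff]
  congr 1
  grind

lemma comp_strandSwap_braid (i : ℕ) (hi : i + 1 < n) (hj : i + 1 + 1 < n) (w : Word N n) :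
    ((w ∘ strandSwap i hi) ∘ strandSwap (i + 1) hj) ∘ strandSwap i hi =
      ((w ∘ strandSwap (i + 1) hj) ∘ strandSwap i hi) ∘ strandSwap (i + 1) hj := by
  funext k
  simp only [Function.comp_apply, strandSwap, Equiv.swap_apply_def, Fin.ext_iff]
  congr 1
  grind

lemma braidMatrix_comm (u c : K) (i j : ℕ) (hi : i + 1 < n) (hj : j + 1 < n) (hij : i + 1 < j) :
    (braidMatrix u c i hi * braidMatrix u c j hj : WordMatrix N K n) =
      braidMatrix u c j hj * braidMatrix u c i hi := by
  suffices h : ∀ M : WordMatrix N K n, braidMatrix u c i hi * (braidMatrix u c j hj * M) =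
      braidMatrix u c j hj * (braidMatrix u c i hi * M) by simpa using h 1
  intro M
  ext w v
  simp only [braidMatrix_mul_apply]
  rw [comp_strandSwap_of_ne i hi w ⟨j, _⟩ (by simp; omega) (by simp; omega),
    comp_strandSwap_of_ne i hi w ⟨j + 1, _⟩ (by simp; omega) (by simp; omega),
    comp_strandSwap_of_ne j hj w ⟨i, _⟩ (by simp; omega) (by simp; omega),
    comp_strandSwap_of_ne j hj w ⟨i + 1, _⟩ (by simp; omega) (by simp; omega),
    comp_strandSwap_comm i j hi hj hij]
  ring

lemma braidMatrix_braid {u c : K} (hu : u * u = 1 + c * u) (i : ℕ) (hi : i + 1 < n)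
    (hj : i + 1 + 1 < n) :
    (braidMatrix u c i hi * braidMatrix u c (i + 1) hj * braidMatrix u c i hi :
      WordMatrix N K n) =
      braidMatrix u c (i + 1) hj * braidMatrix u c i hi * braidMatrix u c (i + 1) hj := by
  suffices h : ∀ M : WordMatrix N K n,
      braidMatrix u c i hi * (braidMatrix u c (i + 1) hj * (braidMatrix u c i hi * M)) =
      braidMatrix u c (i + 1) hj * (braidMatrix u c i hi * (braidMatrix u c (i + 1) hj * M)) by
    simpa [mul_assoc] using h 1
  intro M
  ext w v
  have e1 : ∀ w : Word N n, (w ∘ strandSwap i hi) ⟨i + 1 + 1, hj⟩ = w ⟨i + 1 + 1, hj⟩ :=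
    fun w => comp_strandSwap_of_ne _ _ _ _ (by simp; omega) (by simp)
  have e2 : ∀ w : Word N n, (w ∘ strandSwap (i + 1) hj) ⟨i, Nat.lt_of_succ_lt hi⟩ =
      w ⟨i, Nat.lt_of_succ_lt hi⟩ :=
    fun w => comp_strandSwap_of_ne _ _ _ _ (by simp) (by simp; omega)
  simp only [braidMatrix_mul_apply, comp_strandSwap_left, comp_strandSwap_right, e1, e2,
    comp_strandSwap_self, comp_strandSwap_braid]
  linear_combination exch_braid hu (w ⟨i, Nat.lt_of_succ_lt hi⟩) (w ⟨i + 1, hi⟩)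
    (w ⟨i + 1 + 1, hj⟩) (M w v) (M (w ∘ strandSwap i hi) v) (M (w ∘ strandSwap (i + 1) hj) v)
    (fun h => by rw [comp_strandSwap_eq _ _ _ h]) (fun h => by rw [comp_strandSwap_eq _ _ _ h])

lemma colourMatrix_comm (κ : ZMod d → K) (i j : Fin n) :
    (colourMatrix κ i * colourMatrix κ j : WordMatrix N K n) =
      colourMatrix κ j * colourMatrix κ i := by
  simp only [colourMatrix, diagonal_mul_diagonal, mul_comm]

lemma colourMatrix_pow (κ : ZMod d → K) (j : Fin n) (s : ℕ) :
    (colourMatrix κ j : WordMatrix N K n) ^ s = diagonal fun w => κ (w j).1 ^ s := by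
  rw [colourMatrix, diagonal_pow]; rfl

lemma exch_colour (u c : K) (x y : Letter N) : x.1 = y.1 ∨ exch u c x y = 0 := by
  by_cases h : x = y
  · exact Or.inl (h ▸ rfl)
  · rw [exch_of_ne u c h]
    by_cases h' : x.1 = y.1
    · exact Or.inl h'
    · exact Or.inr (if_neg fun h => h' h.1)

/-- The swap part of the R-matrix permutes positions, which moves the framing; the diagonal part
vanishes unless both letters have the same colour, and then it does not matter which of them is
read. -/
lemma colourMatrix_mul_braidMatrix (κ : ZMod d → K) (u c : K)
    (i : ℕ) (hi : i + 1 < n) (j : Fin n) :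
    (colourMatrix κ j * braidMatrix u c i hi : WordMatrix N K n) =
      braidMatrix u c i hi * colourMatrix κ (strandSwap i hi j) := by
  ext w v
  rw [colourMatrix_mul_apply, braidMatrix_mul_apply]
  simp only [colourMatrix, diagonal_apply, braidMatrix, mul_add]
  congr 1
  · simp only [eq_comm (a := v), Function.comp_apply, strandSwap_strandSwap, mul_ite, mul_one,
      mul_zero]
  · simp only [eq_comm (a := v)]
    split_ifs with h
    · rcases exch_colour u c (w ⟨i, Nat.lt_of_succ_lt hi⟩) (w ⟨i + 1, hi⟩) with h1 | h1
      · rw [mul_comm]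
        congr 2
        by_cases h2 : (j : ℕ) = i
        · obtain rfl : j = ⟨i, Nat.lt_of_succ_lt hi⟩ := Fin.ext h2
          rw [strandSwap_left, h1]
        · by_cases h3 : (j : ℕ) = i + 1
          · obtain rfl : j = ⟨i + 1, hi⟩ := Fin.ext h3
            rw [strandSwap_right, h1]
          · rw [strandSwap_of_ne _ _ _ h2 h3]
      · rw [h1]; ring
    · ring

lemma braidMatrix_sq {u c : K} (hu : u * u = 1 + c * u) (i : ℕ) (hi : i + 1 < n) :
    (braidMatrix u c i hi * braidMatrix u c i hi : WordMatrix N K n) = 1 + c •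
      ((diagonal fun w => if (w ⟨i, Nat.lt_of_succ_lt hi⟩).1 = (w ⟨i + 1, hi⟩).1 then (1 : K)
        else 0) * braidMatrix u c i hi) := by
  suffices h : ∀ M : WordMatrix N K n, braidMatrix u c i hi * (braidMatrix u c i hi * M) =
      M + c • ((diagonal fun w => if (w ⟨i, Nat.lt_of_succ_lt hi⟩).1 = (w ⟨i + 1, hi⟩).1 then
        (1 : K) else 0) * (braidMatrix u c i hi * M)) by simpa using h 1
  intro M
  ext w v
  simp only [Matrix.add_apply, Matrix.smul_apply, diagonal_mul, braidMatrix_mul_apply,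
    comp_strandSwap_left, comp_strandSwap_right, comp_strandSwap_self, smul_eq_mul]
  exact exch_quad hu _ _ _ _ (fun h => by rw [comp_strandSwap_eq _ _ _ h])

/-- The additive character `k ↦ exp(2πi k / d)` with values in a `ℂ`-algebra. -/
def rootChar (d : ℕ) [NeZero d] (K : Type*) [CommRing K] [Algebra ℂ K] (k : ZMod d) : K :=
  algebraMap ℂ K (ZMod.stdAddChar k)

lemma sum_range_eq_sum_zmod {M : Type*} [AddCommMonoid M] (f : ZMod d → M) :
    ∑ s ∈ Finset.range d, f (s : ZMod d) = ∑ s : ZMod d, f s := by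
  refine Finset.sum_nbij' (fun s : ℕ => (s : ZMod d)) (fun s : ZMod d => s.val) ?_ ?_ ?_ ?_ ?_
  · simp
  · intro s _; simpa using ZMod.val_lt s
  · intro s hs; exact ZMod.val_cast_of_lt (Finset.mem_range.1 hs)
  · intro s _; simp
  · simp

lemma rootChar_pow [Algebra ℂ K] (x : ZMod d) (s : ℕ) :
    rootChar d K x ^ s = rootChar d K ((s : ZMod d) * x) := by
  rw [rootChar, ← map_pow, ← AddChar.map_nsmul_eq_pow, nsmul_eq_mul, rootChar]

/-- Orthogonality of the characters of ℤ/dℤ; as a consequence e_i acts as the projector onto words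
whose letters i and i + 1 have equal colour. -/
lemma sum_rootChar [Algebra ℂ K] (x y : ZMod d) :
    (1 / (d : ℂ)) • ∑ s ∈ Finset.range d, rootChar d K x ^ s * rootChar d K y ^ ((d - s) % d) =
      if x = y then 1 else 0 := by
  have hd : (d : ℂ) ≠ 0 := Nat.cast_ne_zero.mpr (NeZero.ne d)
  have h1 : ∀ s ∈ Finset.range d, rootChar d K x ^ s * rootChar d K y ^ ((d - s) % d) =
      algebraMap ℂ K (ZMod.stdAddChar ((s : ZMod d) * (x - y))) := by
    intro s hs
    rw [rootChar_pow, rootChar_pow, rootChar, rootChar, ← map_mul, ← AddChar.map_add_eq_mul]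
    congr 2
    rw [ZMod.natCast_mod, Nat.cast_sub (Finset.mem_range.1 hs).le, ZMod.natCast_self]
    ring
  rw [Finset.sum_congr rfl h1, sum_range_eq_sum_zmod
    (fun s => algebraMap ℂ K (ZMod.stdAddChar (s * (x - y)))), ← map_sum,
    AddChar.sum_mulShift (x - y) (ZMod.isPrimitive_stdAddChar d)]
  simp only [sub_eq_zero, ZMod.card]
  split_ifs
  · rw [Algebra.smul_def, ← map_mul, one_div, inv_mul_cancel₀ hd, map_one]
  · simp

lemma colourMatrix_idem [Algebra ℂ K] (i j : Fin n) :
    (1 / (d : ℂ)) • ∑ s ∈ Finset.range d, (colourMatrix (rootChar d K) i : WordMatrix N K n) ^ s *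
      colourMatrix (rootChar d K) j ^ ((d - s) % d) =
      diagonal fun w => if (w i).1 = (w j).1 then (1 : K) else 0 := by
  simp only [colourMatrix_pow, diagonal_mul_diagonal]
  ext w v
  simp only [Matrix.smul_apply, Matrix.sum_apply, diagonal_apply]
  split_ifs with h h'
  · rw [sum_rootChar, if_pos h']
  · rw [sum_rootChar, if_neg h']
  · simp

variable (N K n) in
/-- `braidMatrix` for an arbitrary natural number, with value `0` outside the range. -/
def braidMatrixNat (u c : K) (i : ℕ) : WordMatrix N K n :=
  if h : i + 1 < n then braidMatrix u c i h else 0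

variable (N K n) in
/-- `colourMatrix` for an arbitrary natural number, with value `0` outside the range. -/
def colourMatrixNat (κ : ZMod d → K) (j : ℕ) : WordMatrix N K n :=
  if h : j < n then colourMatrix κ ⟨j, h⟩ else 0

lemma braidMatrixNat_of_lt (u c : K) {i : ℕ} (h : i + 1 < n) :
    braidMatrixNat N K n u c i = braidMatrix u c i h := dif_pos h

lemma colourMatrixNat_of_lt (κ : ZMod d → K) {j : ℕ} (h : j < n) :
    colourMatrixNat N K n κ j = colourMatrix κ ⟨j, h⟩ := dif_pos h

theorem isYokonumaSystem_braidMatrix [Algebra ℂ A] [Algebra ℂ K] [IsScalarTower ℂ A K] (r : A)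
    {u : K} (hu : u * u = 1 + algebraMap A K r * u) :
    IsYokonumaSystem d n (quadCoeff d r) (braidMatrixNat N K n u (algebraMap A K r))
      (colourMatrixNat N K n (rootChar d K)) where
  braid i hi := by
    rw [braidMatrixNat_of_lt _ _ hi, braidMatrixNat_of_lt _ _ (by omega : i + 1 < n)]
    exact braidMatrix_braid hu i _ _
  comm i j hij hj := by
    rw [braidMatrixNat_of_lt _ _ hj, braidMatrixNat_of_lt _ _ (by omega : i + 1 < n)]
    exact braidMatrix_comm _ _ i j _ _ hij
  framing_comm i j hi hj := by
    rw [colourMatrixNat_of_lt _ hi, colourMatrixNat_of_lt _ hj, colourMatrix_comm]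
  framing_left i hi := by
    rw [braidMatrixNat_of_lt _ _ hi, colourMatrixNat_of_lt _ hi,
      colourMatrixNat_of_lt _ (Nat.lt_of_succ_lt hi),
      colourMatrix_mul_braidMatrix _ _ _, strandSwap_left]
  framing_right i hi := by
    rw [braidMatrixNat_of_lt _ _ hi, colourMatrixNat_of_lt _ hi,
      colourMatrixNat_of_lt _ (Nat.lt_of_succ_lt hi),
      colourMatrix_mul_braidMatrix _ _ _, strandSwap_right]
  framing_far i j hi hj h1 h2 := by
    rw [braidMatrixNat_of_lt _ _ hi, colourMatrixNat_of_lt _ hj,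
      colourMatrix_mul_braidMatrix _ _ _, strandSwap_of_ne _ _ _ h1 h2]
  quad i hi := by
    rw [sum_range_quadCoeff_mul, braidMatrixNat_of_lt _ _ hi, colourMatrixNat_of_lt _ hi,
      colourMatrixNat_of_lt _ (Nat.lt_of_succ_lt hi), colourMatrix_idem, braidMatrix_sq hu,
      algebraMap_smul]

end

/-! ### Adding a letter, weighted traces and the Markov property. -/

section

open Matrix

set_option linter.unusedSectionVars false

variable {d : ℕ} [NeZero d] {N : ZMod d → ℕ} {A K : Type*} [CommRing A] [CommRing K]
  [Algebra A K] {n : ℕ}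

/-- The word `w` followed by the letter `x`. -/
def wordSnoc (w : Word N n) (x : Letter N) : Word N (n + 1) :=
  Fin.snoc (α := fun _ => Letter N) w x

@[simp] lemma wordSnoc_castSucc (w : Word N n) (x : Letter N) (j : Fin n) :
    wordSnoc w x j.castSucc = w j := Fin.snoc_castSucc (α := fun _ => Letter N) x w j

@[simp] lemma wordSnoc_last (w : Word N n) (x : Letter N) : wordSnoc w x (Fin.last n) = x :=
  Fin.snoc_last (α := fun _ => Letter N) x w

lemma wordSnoc_inj {w w' : Word N n} {x x' : Letter N} :
    wordSnoc w x = wordSnoc w' x' ↔ w = w' ∧ x = x' := by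
  constructor
  · intro h
    refine ⟨funext fun j => ?_, ?_⟩
    · simpa using congrFun h j.castSucc
    · simpa using congrFun h (Fin.last n)
  · rintro ⟨rfl, rfl⟩; rfl

lemma exists_wordSnoc (w : Word N (n + 1)) : ∃ v x, w = wordSnoc v x :=
  ⟨fun j => w j.castSucc, w (Fin.last n), (Fin.snoc_init_self (α := fun _ => Letter N) w).symm⟩

lemma sum_word_succ {M : Type*} [AddCommMonoid M] (f : Word N (n + 1) → M) :
    ∑ w, f w = ∑ w : Word N n, ∑ x : Letter N, f (wordSnoc w x) := by
  rw [Finset.sum_comm, ← Fintype.sum_prod_type']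
  exact (Fintype.sum_equiv (Fin.snocEquiv fun _ => Letter N) _ _ fun _ => rfl).symm

lemma wordSnoc_comp_strandSwap (w : Word N n) (x : Letter N) (i : ℕ) (hi : i + 1 < n) :
    wordSnoc w x ∘ strandSwap (n := n + 1) i (Nat.lt_succ_of_lt hi) = wordSnoc (w ∘ strandSwap i hi) x := by
  funext j
  induction j using Fin.lastCases with
  | last =>
    rw [comp_strandSwap_of_ne _ _ _ _ (by simp; omega) (by simp; omega)]
    simp
  | cast j =>
    rw [Function.comp_apply, ← strandSwap_castSucc, wordSnoc_castSucc, wordSnoc_castSucc]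
    rfl

variable (A) in
/-- The action on the first `n` letters of a word of length `n + 1`. -/
def inclMatrix : WordMatrix N K n →ₐ[A] WordMatrix N K (n + 1) :=
  AlgHom.ofLinearMap
    { toFun := fun M => Matrix.of fun w v => if w (Fin.last n) = v (Fin.last n) then
        M (fun j => w j.castSucc) (fun j => v j.castSucc) else 0
      map_add' := fun M M' => by
        ext w v
        simp only [Matrix.of_apply, Matrix.add_apply]
        split_ifs <;> simp
      map_smul' := fun r M => by
        ext w v
        simp only [Matrix.of_apply, Matrix.smul_apply, RingHom.id_apply]
        split_ifs <;> simp }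
    (by
      ext w v
      obtain ⟨w, x, rfl⟩ := exists_wordSnoc w
      obtain ⟨v, y, rfl⟩ := exists_wordSnoc v
      simp only [LinearMap.coe_mk, AddHom.coe_mk, Matrix.of_apply, wordSnoc_last,
        wordSnoc_castSucc, Matrix.one_apply, wordSnoc_inj]
      split_ifs <;> simp_all)
    (fun M M' => by
      ext w v
      obtain ⟨w, x, rfl⟩ := exists_wordSnoc w
      obtain ⟨v, y, rfl⟩ := exists_wordSnoc v
      simp only [LinearMap.coe_mk, AddHom.coe_mk, Matrix.of_apply, Matrix.mul_apply,
        sum_word_succ, wordSnoc_last, wordSnoc_castSucc]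
      by_cases h : x = y <;> simp [h])

lemma inclMatrix_apply (M : WordMatrix N K n) (w v : Word N n) (x y : Letter N) :
    inclMatrix A M (wordSnoc w x) (wordSnoc v y) = if x = y then M w v else 0 := by
  simp [inclMatrix]

lemma inclMatrix_braidMatrix (u c : K) (i : ℕ) (hi : i + 1 < n) :
    inclMatrix A (braidMatrix u c i hi : WordMatrix N K n) =
      braidMatrix (n := n + 1) u c i (Nat.lt_succ_of_lt hi) := by
  ext w v
  obtain ⟨w, x, rfl⟩ := exists_wordSnoc w
  obtain ⟨v, y, rfl⟩ := exists_wordSnoc v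
  rw [inclMatrix_apply]
  have h1 : wordSnoc w x ⟨i, by omega⟩ = w ⟨i, by omega⟩ := wordSnoc_castSucc w x ⟨i, by omega⟩
  have h2 : wordSnoc w x ⟨i + 1, by omega⟩ = w ⟨i + 1, hi⟩ := wordSnoc_castSucc w x ⟨i + 1, hi⟩
  simp only [braidMatrix, h1, h2]
  rw [wordSnoc_comp_strandSwap w x i hi]
  simp only [wordSnoc_inj]
  by_cases h : x = y
  · simp [h]
  · simp [h, Ne.symm h]

lemma inclMatrix_colourMatrix (κ : ZMod d → K) (j : Fin n) :
    inclMatrix A (colourMatrix κ j : WordMatrix N K n) = colourMatrix κ j.castSucc := by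
  ext w v
  obtain ⟨w, x, rfl⟩ := exists_wordSnoc w
  obtain ⟨v, y, rfl⟩ := exists_wordSnoc v
  rw [inclMatrix_apply]
  simp only [colourMatrix, diagonal_apply, wordSnoc_inj, wordSnoc_castSucc]
  split_ifs <;> simp_all

/-- The weight of a word: the product of the weights of its letters. -/
def wordWeight (D : Letter N → K) (w : Word N n) : K := ∏ j, D (w j)

lemma wordWeight_snoc (D : Letter N → K) (w : Word N n) (x : Letter N) :
    wordWeight D (wordSnoc w x) = wordWeight D w * D x := by
  simp [wordWeight, Fin.prod_univ_castSucc]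

lemma wordWeight_comp (D : Letter N → K) (w : Word N n) (i : ℕ) (hi : i + 1 < n) :
    wordWeight D (w ∘ strandSwap i hi) = wordWeight D w :=
  Equiv.prod_comp (strandSwap i hi) fun j => D (w j)

variable (n) in
/-- The diagonal matrix of the weights of the words. -/
def weightMatrix (D : Letter N → K) : WordMatrix N K n := diagonal (wordWeight D)

variable (A n) in
/-- The weighted trace of an operator on words. -/
def wordTrace (D : Letter N → K) : WordMatrix N K n →ₗ[A] K where
  toFun M := ∑ w, M w w * wordWeight D w
  map_add' M M' := by simp [add_mul, Finset.sum_add_distrib]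
  map_smul' r M := by simp [Finset.smul_sum]

lemma wordTrace_apply (D : Letter N → K) (M : WordMatrix N K n) :
    wordTrace A n D M = ∑ w, M w w * wordWeight D w := rfl

lemma wordTrace_eq_trace (D : Letter N → K) (M : WordMatrix N K n) :
    wordTrace A n D M = Matrix.trace (M * weightMatrix n D) := by
  simp [wordTrace_apply, weightMatrix, Matrix.trace, mul_diagonal]

/-- The weighted trace is the matrix trace of M times the weight matrix, so it is cyclic as soon as
one factor commutes with the weights. The generators do, because a swap leaves the product of letter
weights unchanged. -/
lemma wordTrace_mul_comm (D : Letter N → K) (M M' : WordMatrix N K n)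
    (h : Commute M' (weightMatrix n D)) :
    wordTrace A n D (M * M') = wordTrace A n D (M' * M) := by
  rw [wordTrace_eq_trace, wordTrace_eq_trace, mul_assoc, h.eq, ← mul_assoc, Matrix.trace_mul_comm,
    mul_assoc]

lemma commute_braidMatrix (D : Letter N → K) (u c : K) (i : ℕ) (hi : i + 1 < n) :
    Commute (braidMatrix u c i hi) (weightMatrix n D) := by
  ext w v
  rw [weightMatrix, mul_diagonal, diagonal_mul, braidMatrix]
  simp only [add_mul, mul_add, ite_mul, mul_ite, one_mul, mul_one, zero_mul, mul_zero]
  congr 1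
  · split_ifs with h
    · rw [h, wordWeight_comp]
    · rfl
  · split_ifs with h
    · rw [h, mul_comm]
    · rfl

lemma commute_colourMatrix (D : Letter N → K) (κ : ZMod d → K) (j : Fin n) :
    Commute (colourMatrix κ j) (weightMatrix n D) := by
  rw [Commute, SemiconjBy, weightMatrix, colourMatrix, diagonal_mul_diagonal,
    diagonal_mul_diagonal]
  simp only [mul_comm]

lemma wordTrace_zero_one (D : Letter N → K) : wordTrace A 0 D 1 = 1 := by
  simp [wordTrace_apply, wordWeight]

lemma wordTrace_incl_mul_colourMatrix_pow (D : Letter N → K) (κ : ZMod d → K) (s : ℕ)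
    (M : WordMatrix N K n) :
    wordTrace A (n + 1) D (inclMatrix A M * colourMatrix κ (Fin.last n) ^ s) =
      (∑ x, κ x.1 ^ s * D x) * wordTrace A n D M := by
  rw [wordTrace_apply, wordTrace_apply, sum_word_succ, Finset.mul_sum]
  refine Finset.sum_congr rfl fun w _ => ?_
  rw [Finset.sum_mul]
  refine Finset.sum_congr rfl fun x _ => ?_
  rw [colourMatrix_pow, mul_diagonal, inclMatrix_apply, if_pos rfl, wordWeight_snoc, wordSnoc_last]
  ring

/-- The hypothesis `hD` says that the partial trace of the weighted R-matrix over its last letter is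
the scalar z; summing over the last letter of the word gives the Markov rule. -/
lemma wordTrace_incl_mul_braidMatrix (D : Letter N → K) (u c z : K)
    (hD : ∀ y : Letter N, ∑ x, ((if x = y then 1 else 0) + exch u c y x) * D x = z)
    (M : WordMatrix N K (n + 1)) :
    wordTrace A (n + 2) D (inclMatrix A M * braidMatrix u c n (Nat.lt_succ_self (n + 1))) =
      z * wordTrace A (n + 1) D M := by
  rw [wordTrace_mul_comm D _ _ (commute_braidMatrix D u c _ _), wordTrace_apply, wordTrace_apply,
    sum_word_succ, Finset.mul_sum]
  refine Finset.sum_congr rfl fun w _ => ?_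
  rw [← hD (w (Fin.last n)), Finset.sum_mul]
  refine Finset.sum_congr rfl fun x _ => ?_
  have h1 : wordSnoc w x ⟨n, by omega⟩ = w (Fin.last n) := wordSnoc_castSucc w x (Fin.last n)
  have h2 : wordSnoc w x ⟨n + 1, by omega⟩ = x := wordSnoc_last w x
  -- An included matrix preserves the last letter, so the swapped word contributes only when the two
  -- letters exchanged are equal.
  have h3 : inclMatrix A M (wordSnoc w x ∘ strandSwap n (Nat.lt_succ_self (n + 1)))
      (wordSnoc w x) = if x = w (Fin.last n) then M w w else 0 := by
    split_ifs with h
    · rw [comp_strandSwap_eq _ _ _ (by rw [h1, h2, h]), inclMatrix_apply, if_pos rfl]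
    · obtain ⟨v, y, e⟩ := exists_wordSnoc (wordSnoc w x ∘ strandSwap n (Nat.lt_succ_self (n + 1)))
      have hy : y = w (Fin.last n) := by
        rw [← wordSnoc_last v y, ← e]
        exact (comp_strandSwap_right _ _ _).trans h1
      rw [e, inclMatrix_apply, if_neg (fun h' => h (h'.symm.trans hy))]
  rw [braidMatrix_mul_apply, h1, h2, h3, inclMatrix_apply, if_pos rfl, wordWeight_snoc]
  split_ifs <;> ring

/-- The weight `z u^{-1-2i}` of the `i`-th letter of a colour, where `v = u⁻¹`. -/
def letterWeight (v z : K) (x : Letter N) : K := z * v ^ (1 + 2 * (x.2 : ℕ))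

lemma sum_range_letterWeight {u v : K} (h : u * v = 1) (i : ℕ) :
    (u - v) * ∑ k ∈ Finset.range i, v ^ (1 + 2 * k) = 1 - v ^ (2 * i) := by
  induction i with
  | zero => simp
  | succ i ih =>
    rw [Finset.sum_range_succ, mul_add, ih, show 2 * (i + 1) = 2 * i + 2 by ring]
    linear_combination v ^ (2 * i) * h

/-- For the i-th letter of a colour the sum is u·z v^{1+2i} plus (u - v) times the weights of the
earlier letters of that colour. The geometric sum telescopes: z v^{2i} + z(1 - v^{2i}) = z. This is
what dictates the weights. -/
lemma sum_exch_letterWeight {u v : K} (h : u * v = 1) (z : K) (y : Letter N) :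
    ∑ x, ((if x = y then 1 else 0) + exch u (u - v) y x) * letterWeight v z x = z := by
  obtain ⟨χ, i⟩ := y
  have e : ∀ x : Letter N, ((if x = ⟨χ, i⟩ then 1 else 0) + exch u (u - v) ⟨χ, i⟩ x) *
      letterWeight v z x = (if x = ⟨χ, i⟩ then u * letterWeight v z x else 0) +
        if χ = x.1 ∧ (x.2 : ℕ) < i then (u - v) * letterWeight v z x else 0 := by
    intro x
    by_cases hx : x = ⟨χ, i⟩
    · subst hx
      simp [exch_self]
    · rw [exch_of_ne _ _ (Ne.symm hx)]
      simp [hx]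
  rw [Finset.sum_congr rfl fun x _ => e x, Finset.sum_add_distrib, Finset.sum_ite_eq',
    if_pos (Finset.mem_univ _), Fintype.sum_sigma, Finset.sum_eq_single χ]
  · have e2 : ∑ j : Fin (N χ), (if χ = χ ∧ (j : ℕ) < i then
        (u - v) * letterWeight v z (⟨χ, j⟩ : Letter N) else 0) =
        (u - v) * (z * ∑ k ∈ Finset.range i, v ^ (1 + 2 * k)) := by
      simp only [true_and, letterWeight]
      rw [Finset.mul_sum, Finset.mul_sum,
        Fin.sum_univ_eq_sum_range (fun j => if j < (i : ℕ) then (u - v) * (z * v ^ (1 + 2 * j))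
          else 0) (N χ), ← Finset.sum_filter]
      refine Finset.sum_congr ?_ fun _ _ => rfl
      ext k
      have := i.2
      simp only [Finset.mem_filter, Finset.mem_range]
      omega
    rw [e2, letterWeight]
    linear_combination z * v ^ (2 * (i : ℕ)) * h + z * sum_range_letterWeight h (i : ℕ)
  · intro χ' _ hne
    simp [Ne.symm hne]
  · simp

end

/-! ### The generic ring of parameters and its special values -/

/-- The ring `ℂ[r, z, y_χ]`, where `r` is the parameter of the quadratic relation and the
`y_χ`, for `χ ∈ ℤ/dℤ`, are the weights of the colours. -/
abbrev ParamRing (d : ℕ) : Type := MvPolynomial (Option (Option (ZMod d))) ℂ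

/-- The parameter of the quadratic relation. -/
def rParam (d : ℕ) : ParamRing d := MvPolynomial.X none

/-- The parameter `z`. -/
def zParam (d : ℕ) : ParamRing d := MvPolynomial.X (some none)

/-- The weight of a colour. -/
def yParam (d : ℕ) (χ : ZMod d) : ParamRing d := MvPolynomial.X (some (some χ))

/-- An R-matrix model: `u = k + 2`, `z = l + 1`, and `N χ` letters of colour `χ`. -/
structure ModelParam (d : ℕ) where
  k : ℕ
  l : ℕ
  N : ZMod d → ℕ

namespace ModelParam

variable {d : ℕ}

/-- The weight of a colour with `N` letters. -/
def colourWeight (k l N : ℕ) : ℂ :=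
  ∑ i ∈ Finset.range N, ((l : ℂ) + 1) * ((k : ℂ) + 2)⁻¹ ^ (1 + 2 * i)

/-- The values of the generic parameters in the model. -/
def point (θ : ModelParam d) : Option (Option (ZMod d)) → ℂ
  | none => ((θ.k : ℂ) + 2) - ((θ.k : ℂ) + 2)⁻¹
  | some none => (θ.l : ℂ) + 1
  | some (some χ) => colourWeight θ.k θ.l (θ.N χ)

lemma add_two_ne_zero (k : ℕ) : (k : ℂ) + 2 ≠ 0 := by exact_mod_cast (Nat.succ_ne_zero (k + 1))

/-- Multiplying by u - u⁻¹ turns the geometric sum into (l + 1)(1 - u^{-2N}). The choices u = k + 2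
≥ 2 and z = l + 1 ≠ 0 make these values distinct for distinct N. -/
lemma colourWeight_injective (k l : ℕ) : Function.Injective (colourWeight k l) := by
  intro N M h
  have hk := add_two_ne_zero k
  have key : ∀ N, (((k : ℂ) + 2) - ((k : ℂ) + 2)⁻¹) * colourWeight k l N =
      ((l : ℂ) + 1) * (1 - ((k : ℂ) + 2)⁻¹ ^ (2 * N)) := by
    intro N
    rw [colourWeight, ← Finset.mul_sum, ← sum_range_letterWeight (mul_inv_cancel₀ hk) N]
    ring
  have hl : (l : ℂ) + 1 ≠ 0 := Nat.cast_add_one_ne_zero l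
  have h2 := (key N).symm.trans ((congrArg _ h).trans (key M))
  have h3 : ((k : ℂ) + 2)⁻¹ ^ (2 * N) = ((k : ℂ) + 2)⁻¹ ^ (2 * M) := by
    have := mul_left_cancel₀ hl h2
    linear_combination -this
  rw [inv_pow, inv_pow, inv_inj] at h3
  have h4 : (k + 2) ^ (2 * N) = (k + 2) ^ (2 * M) := by exact_mod_cast h3
  have := Nat.pow_right_injective (by omega : 2 ≤ k + 2) h4
  omega

lemma rValue_injective :
    Function.Injective fun k : ℕ => ((k : ℂ) + 2) - ((k : ℂ) + 2)⁻¹ := by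
  intro k k' h
  have hk := add_two_ne_zero k
  have hk' := add_two_ne_zero k'
  dsimp only at h
  field_simp at h
  have h1 : ((k : ℂ) - k') * (((k : ℂ) + 2) * (k' + 2) + 1) = 0 := by linear_combination h
  rcases mul_eq_zero.1 h1 with h2 | h2
  · exact_mod_cast sub_eq_zero.1 h2
  · have : (k + 2) * (k' + 2) + 1 = 0 := by exact_mod_cast h2
    omega

/-- The special values of the generic parameters are Zariski dense. -/
theorem eq_zero_of_eval_point (p : ParamRing d)
    (hp : ∀ θ : ModelParam d, MvPolynomial.eval θ.point p = 0) : p = 0 := by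
  -- The attainable y_χ depend on k and l, so the special values do not form a product set. Density
  -- is proved in two steps: first for all y_χ at fixed r and z, then in r and z.
  refine MvPolynomial.funext_set (fun o : Option (Option (ZMod d)) => match o with
    | none => Set.range fun k : ℕ => ((k : ℂ) + 2) - ((k : ℂ) + 2)⁻¹
    | some none => Set.range fun l : ℕ => (l : ℂ) + 1
    | some (some _) => Set.univ) ?_ ?_
  · rintro (_ | _ | _)
    · exact Set.infinite_range_of_injective rValue_injective
    · exact Set.infinite_range_of_injective fun a b h => by simpa using h
    · exact Set.infinite_univ
  · intro x hx
    rw [map_zero]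
    obtain ⟨k, hk⟩ := hx none (Set.mem_univ _)
    obtain ⟨l, hl⟩ := hx (some none) (Set.mem_univ _)
    let f : ParamRing d →ₐ[ℂ] MvPolynomial (ZMod d) ℂ := MvPolynomial.aeval fun o => match o with
      | none => MvPolynomial.C (x none)
      | some none => MvPolynomial.C (x (some none))
      | some (some χ) => MvPolynomial.X χ
    have hf : ∀ v : ZMod d → ℂ, MvPolynomial.eval v (f p) =
        MvPolynomial.eval (fun o => match o with
          | none => x none
          | some none => x (some none)
          | some (some χ) => v χ) p := by
      intro v
      have : ((MvPolynomial.aeval v : MvPolynomial (ZMod d) ℂ →ₐ[ℂ] ℂ).comp f) =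
          MvPolynomial.aeval (fun o => match o with
          | none => x none
          | some none => x (some none)
          | some (some χ) => v χ) := by
        ext o
        rcases o with _ | _ | χ <;> simp [f]
      simpa [MvPolynomial.coe_aeval_eq_eval] using DFunLike.congr_fun this p
    -- With r and z frozen at the values given by k and l, each y_χ still ranges over infinitely
    -- many colour weights, so the polynomial in the y_χ vanishes identically.
    have h0 : f p = 0 := by
      refine MvPolynomial.funext_set (fun _ => Set.range (colourWeight k l))
        (fun _ => Set.infinite_range_of_injective (colourWeight_injective k l)) ?_
      intro v hv
      choose N hN using fun χ => hv χ (Set.mem_univ χ)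
      rw [map_zero, hf, ← hp ⟨k, l, N⟩]
      congr 2
      funext o
      rcases o with _ | _ | χ
      · exact hk.symm
      · exact hl.symm
      · exact (hN χ).symm
    have h1 := hf fun χ => x (some (some χ))
    rw [h0, map_zero] at h1
    rw [h1]
    congr 2
    funext o
    rcases o with _ | _ | χ <;> rfl

/-- The field of complex numbers, as an algebra over the generic ring of parameters by means of
the values of the parameters in the model. -/
def Val (_ : ModelParam d) : Type := ℂ

instance (θ : ModelParam d) : CommRing θ.Val := inferInstanceAs (CommRing ℂ)

instance (θ : ModelParam d) : Algebra ℂ θ.Val := inferInstanceAs (Algebra ℂ ℂ)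

instance (θ : ModelParam d) : Algebra (ParamRing d) θ.Val :=
  RingHom.toAlgebra (MvPolynomial.eval θ.point : ParamRing d →+* ℂ)

instance (θ : ModelParam d) : IsScalarTower ℂ (ParamRing d) θ.Val :=
  IsScalarTower.of_algebraMap_eq fun c => (MvPolynomial.eval_C (f := θ.point) c).symm

lemma algebraMap_apply (θ : ModelParam d) (p : ParamRing d) :
    algebraMap (ParamRing d) θ.Val p = MvPolynomial.eval θ.point p := rfl

/-- The parameter `u` of the R-matrix. -/
def uVal (θ : ModelParam d) : θ.Val := ((θ.k : ℂ) + 2 : ℂ)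

/-- The inverse of `u`. -/
def vVal (θ : ModelParam d) : θ.Val := (((θ.k : ℂ) + 2)⁻¹ : ℂ)

lemma uVal_mul_vVal (θ : ModelParam d) : θ.uVal * θ.vVal = 1 :=
  mul_inv_cancel₀ (add_two_ne_zero θ.k)

lemma algebraMap_rParam (θ : ModelParam d) :
    algebraMap (ParamRing d) θ.Val (rParam d) = θ.uVal - θ.vVal :=
  MvPolynomial.eval_X (f := θ.point) none

lemma uVal_mul_self (θ : ModelParam d) :
    θ.uVal * θ.uVal = 1 + algebraMap (ParamRing d) θ.Val (rParam d) * θ.uVal := by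
  rw [algebraMap_rParam]
  linear_combination θ.uVal_mul_vVal

/-- The weights of the letters. -/
def weight (θ : ModelParam d) : Letter θ.N → θ.Val :=
  letterWeight θ.vVal (algebraMap (ParamRing d) θ.Val (zParam d))

lemma algebraMap_zParam (θ : ModelParam d) :
    algebraMap (ParamRing d) θ.Val (zParam d) = ((θ.l : ℂ) + 1 : ℂ) :=
  MvPolynomial.eval_X (f := θ.point) (some none)

lemma sum_weight (θ : ModelParam d) (χ : ZMod d) :
    ∑ i : Fin (θ.N χ), θ.weight ⟨χ, i⟩ = algebraMap (ParamRing d) θ.Val (yParam d χ) := by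
  have h : algebraMap (ParamRing d) θ.Val (yParam d χ) = colourWeight θ.k θ.l (θ.N χ) :=
    MvPolynomial.eval_X (f := θ.point) (some (some χ))
  rw [h]
  simp only [weight, letterWeight, algebraMap_zParam]
  exact Fin.sum_univ_eq_sum_range
    (fun i => ((θ.l : ℂ) + 1) * ((θ.k : ℂ) + 2)⁻¹ ^ (1 + 2 * i)) (θ.N χ)

variable [NeZero d]

lemma sum_rootChar_pow_weight (θ : ModelParam d) (s : ℕ) :
    ∑ x : Letter θ.N, rootChar d θ.Val x.1 ^ s * θ.weight x =
      algebraMap (ParamRing d) θ.Val (∑ χ, rootChar d (ParamRing d) χ ^ s * yParam d χ) := by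
  rw [Fintype.sum_sigma, map_sum]
  refine Finset.sum_congr rfl fun χ _ => ?_
  dsimp only
  rw [← Finset.mul_sum, sum_weight, map_mul, map_pow, rootChar, rootChar,
    ← IsScalarTower.algebraMap_apply]

end ModelParam

/-! ### The product of all models, and polynomiality of its traces. -/

section

variable {A : Type*} [CommRing A]

lemma IsYokonumaSystem.pi {ι : Type*} {B : ι → Type*} [∀ θ, Ring (B θ)] [∀ θ, Algebra A (B θ)]
    {d N : ℕ} {c : ℕ → ℕ → A} {g t : ∀ θ, ℕ → B θ}
    (h : ∀ θ, IsYokonumaSystem d N c (g θ) (t θ)) :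
    IsYokonumaSystem d N c (fun i θ => g θ i) (fun i θ => t θ i) where
  braid i hi := funext fun θ => (h θ).braid i hi
  comm i j hij hj := funext fun θ => (h θ).comm i j hij hj
  framing_comm i j hi hj := funext fun θ => (h θ).framing_comm i j hi hj
  framing_left i hi := funext fun θ => (h θ).framing_left i hi
  framing_right i hi := funext fun θ => (h θ).framing_right i hi
  framing_far i j hi hj h1 h2 := funext fun θ => (h θ).framing_far i j hi hj h1 h2
  quad i hi := funext fun θ => by
    simpa using (h θ).quad i hi

end

section

variable (d : ℕ) [NeZero d] (n : ℕ)

/-- The product of the R-matrix models on words of length `n`. -/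
abbrev ModelAlg : Type := ∀ θ : ModelParam d, WordMatrix θ.N θ.Val n

/-- The image of `g_i` in the models. -/
def modelG (i : ℕ) : ModelAlg d n := fun θ =>
  braidMatrixNat θ.N θ.Val n θ.uVal (algebraMap (ParamRing d) θ.Val (rParam d)) i

/-- The image of `t_j` in the models. -/
def modelT (j : ℕ) : ModelAlg d n := fun θ => colourMatrixNat θ.N θ.Val n (rootChar d θ.Val) j

/-- Adding a letter on the right. -/
def modelIncl : ModelAlg d n →ₐ[ParamRing d] ModelAlg d (n + 1) :=
  AlgHom.pi fun θ => (inclMatrix (ParamRing d)).comp (Pi.evalAlgHom _ _ θ)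

/-- The weighted traces in the models. -/
def modelTrace : ModelAlg d n →ₗ[ParamRing d] (∀ θ : ModelParam d, θ.Val) :=
  LinearMap.pi fun θ => (wordTrace (ParamRing d) n θ.weight).comp (LinearMap.proj θ)

/-- The weight of `t_j^s`. -/
def xParam (s : ℕ) : ParamRing d := ∑ χ, rootChar d (ParamRing d) χ ^ s * yParam d χ

variable {d n}

theorem isYokonumaSystem_model :
    IsYokonumaSystem d n (quadCoeff d (rParam d)) (modelG d n) (modelT d n) :=
  IsYokonumaSystem.pi fun θ => isYokonumaSystem_braidMatrix (rParam d) θ.uVal_mul_self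

lemma modelIncl_modelG {i : ℕ} (hi : i + 1 < n) :
    modelIncl d n (modelG d n i) = modelG d (n + 1) i := by
  funext θ
  have h : modelIncl d n (modelG d n i) θ = inclMatrix (ParamRing d) (modelG d n i θ) := rfl
  rw [h, modelG, modelG, braidMatrixNat_of_lt _ _ hi, inclMatrix_braidMatrix,
    braidMatrixNat_of_lt _ _ (Nat.lt_succ_of_lt hi)]

lemma modelIncl_modelT {j : ℕ} (hj : j < n) :
    modelIncl d n (modelT d n j) = modelT d (n + 1) j := by
  funext θ
  have h : modelIncl d n (modelT d n j) θ = inclMatrix (ParamRing d) (modelT d n j θ) := rfl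
  rw [h, modelT, modelT, colourMatrixNat_of_lt _ hj, inclMatrix_colourMatrix,
    colourMatrixNat_of_lt _ (Nat.lt_succ_of_lt hj)]
  rfl

lemma rootChar_pow_card {K : Type*} [CommRing K] [Algebra ℂ K] (χ : ZMod d) :
    rootChar d K χ ^ d = 1 := by
  rw [rootChar_pow, ZMod.natCast_self, zero_mul, rootChar, AddChar.map_zero_eq_one, map_one]

lemma modelT_pow_d {j : ℕ} (hj : j < n) : modelT d n j ^ d = 1 := by
  funext θ
  rw [Pi.pow_apply, modelT, colourMatrixNat_of_lt _ hj, colourMatrix_pow]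
  simp only [rootChar_pow_card, Matrix.diagonal_one]
  rfl

/-- The algebra generated by the `g_i` and `t_j` in the models. -/
abbrev modelSubalgebra (d n : ℕ) [NeZero d] : Subalgebra (ParamRing d) (ModelAlg d n) :=
  strandAlgebra (ParamRing d) (modelG d n) (modelT d n) 0 n

/-- Cyclicity holds once one factor is generated by the g_i and t_j, since such elements commute
with the weights; it fails for arbitrary matrices. -/
lemma modelTrace_mul_comm (a : ModelAlg d n) {b : ModelAlg d n} (hb : b ∈ modelSubalgebra d n) :
    modelTrace d n (a * b) = modelTrace d n (b * a) := by
  have h : Commute b fun θ => weightMatrix n θ.weight := by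
    refine commute_of_mem_adjoin (fun x hx => ?_) hb
    rcases hx with ⟨i, -, h2, rfl⟩ | ⟨j, -, h2, rfl⟩
    · funext θ
      rw [Pi.mul_apply, Pi.mul_apply, modelG, braidMatrixNat_of_lt _ _ h2]
      exact commute_braidMatrix _ _ _ _ _
    · funext θ
      rw [Pi.mul_apply, Pi.mul_apply, modelT, colourMatrixNat_of_lt _ h2]
      exact commute_colourMatrix _ _ _
  funext θ
  exact wordTrace_mul_comm (A := ParamRing d) θ.weight (a θ) (b θ) (congrFun h θ)

lemma modelTrace_zero_one : modelTrace d 0 1 = 1 :=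
  funext fun θ => wordTrace_zero_one (A := ParamRing d) θ.weight

lemma modelTrace_incl_mul_modelT_pow (a : ModelAlg d n) (s : ℕ) :
    modelTrace d (n + 1) (modelIncl d n a * modelT d (n + 1) n ^ s) =
      xParam d s • modelTrace d n a := by
  funext θ
  have h := wordTrace_incl_mul_colourMatrix_pow (A := ParamRing d) θ.weight (rootChar d θ.Val) s
    (a θ)
  rw [θ.sum_rootChar_pow_weight, ← Algebra.smul_def] at h
  rw [Pi.smul_apply]
  refine Eq.trans ?_ h
  have e : modelT d (n + 1) n θ = colourMatrix (rootChar d θ.Val) (Fin.last n) :=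
    colourMatrixNat_of_lt _ (Nat.lt_succ_self n)
  rw [← e]
  rfl

/-- The generic trace is not normalized: a new strand costs the total weight of the letters, x_0 = ∑
y_χ, which becomes 1 only after specialization. -/
lemma modelTrace_incl (a : ModelAlg d n) :
    modelTrace d (n + 1) (modelIncl d n a) = xParam d 0 • modelTrace d n a := by
  simpa using modelTrace_incl_mul_modelT_pow a 0

lemma modelTrace_incl_mul_modelG (a : ModelAlg d (n + 1)) :
    modelTrace d (n + 2) (modelIncl d (n + 1) a * modelG d (n + 2) n) =
      zParam d • modelTrace d (n + 1) a := by
  funext θ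
  have h := wordTrace_incl_mul_braidMatrix (A := ParamRing d) θ.weight θ.uVal (θ.uVal - θ.vVal)
    (algebraMap (ParamRing d) θ.Val (zParam d))
    (fun y => sum_exch_letterWeight θ.uVal_mul_vVal _ y) (a θ)
  rw [← Algebra.smul_def] at h
  rw [Pi.smul_apply]
  refine Eq.trans ?_ h
  have e : modelG d (n + 2) n θ =
      braidMatrix θ.uVal (θ.uVal - θ.vVal) n (Nat.lt_succ_self (n + 1)) := by
    rw [modelG, θ.algebraMap_rParam]
    exact braidMatrixNat_of_lt _ _ (Nat.lt_succ_self (n + 1))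
  rw [← e]
  rfl

lemma exists_modelIncl_eq {x : ModelAlg d (n + 1)}
    (hx : x ∈ strandAlgebra (ParamRing d) (modelG d (n + 1)) (modelT d (n + 1)) 0 n) :
    ∃ y ∈ modelSubalgebra d n, modelIncl d n y = x := by
  rw [← map_strandAlgebra (modelIncl d n) (fun i hi => modelIncl_modelG hi)
    (fun j hj => modelIncl_modelT hj)] at hx
  exact hx

variable (d) in
/-- The simultaneous evaluation of the generic parameters in all models. -/
def evalModels : ParamRing d →ₐ[ParamRing d] (∀ θ : ModelParam d, θ.Val) :=
  Algebra.ofId _ _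

omit [NeZero d] in
variable (d) in
lemma evalModels_injective : Function.Injective (evalModels d) := by
  rw [injective_iff_map_eq_zero]
  intro p hp
  exact ModelParam.eq_zero_of_eval_point p fun θ => congrFun hp θ

/-- The weighted traces of elements generated by the `g_i` and `t_j` are polynomials in the generic
parameters. -/
theorem modelTrace_mem_range (b : ModelAlg d n) (hb : b ∈ modelSubalgebra d n) :
    modelTrace d n b ∈ LinearMap.range (evalModels d).toLinearMap := by
  induction n with
  | zero =>
    rw [modelSubalgebra, strandAlgebra_self] at hb
    obtain ⟨r, rfl⟩ := Algebra.mem_bot.1 hb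
    rw [Algebra.algebraMap_eq_smul_one, map_smul, modelTrace_zero_one]
    exact ⟨r, by rw [AlgHom.toLinearMap_apply, evalModels, Algebra.ofId_apply,
      Algebra.algebraMap_eq_smul_one]⟩
  | succ n ih =>
    have hb' := isYokonumaSystem_model.mem_span_strandCosets 0 n (Nat.lt_succ_self n) b hb
    clear hb
    have hmono := strandAlgebra_mono (A := ParamRing d) (g := modelG d (n + 1))
      (t := modelT d (n + 1)) (le_refl 0) (Nat.le_succ n)
    induction hb' using Submodule.span_induction with
    | mem b hb =>
      rcases hb with ⟨x, hx, s, rfl⟩ | ⟨i, -, rfl, x, hx, y, hy, rfl⟩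
      · obtain ⟨x, hx', rfl⟩ := exists_modelIncl_eq hx
        rw [modelTrace_incl_mul_modelT_pow]
        exact Submodule.smul_mem _ _ (ih x hx')
      -- Cyclicity turns x g_i y into (y x) g_i, and y x comes from words one letter shorter, where
      -- the Markov rule and induction apply.
      · rw [modelTrace_mul_comm _ (hmono hy), ← mul_assoc]
        obtain ⟨x, hx', rfl⟩ := exists_modelIncl_eq hx
        obtain ⟨y, hy', rfl⟩ := exists_modelIncl_eq hy
        rw [← map_mul, modelTrace_incl_mul_modelG]
        exact Submodule.smul_mem _ _ (ih _ (mul_mem hy' hx'))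
    | zero => simp
    | add b b' _ _ h1 h2 => rw [map_add]; exact add_mem h1 h2
    | smul r b _ h => rw [map_smul]; exact Submodule.smul_mem _ _ h

/-! ### The generic trace on the group algebra -/

/-- The generators of the framed braid group in the models. -/
def modelGen : Gen n → ModelAlg d n
  | Gen.sigma i _ => modelG d n i
  | Gen.framing j => modelT d n j

variable (d n) in
/-- The element `e_i` in the models. -/
def modelIdem (i : ℕ) : ModelAlg d n :=
  (1 / (d : ℂ)) • ∑ s ∈ Finset.range d, modelT d n i ^ s * modelT d n (i + 1) ^ ((d - s) % d)

lemma modelG_mul_self {i : ℕ} (hi : i + 1 < n) :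
    modelG d n i * modelG d n i = 1 + rParam d • (modelIdem d n i * modelG d n i) := by
  rw [isYokonumaSystem_model.quad i hi, sum_range_quadCoeff_mul, modelIdem]

lemma sub_mul_modelG {i : ℕ} (hi : i + 1 < n) :
    (modelG d n i - rParam d • modelIdem d n i) * modelG d n i = 1 := by
  rw [sub_mul, modelG_mul_self hi, smul_mul_assoc, add_sub_cancel_right]

lemma modelT_pow_mul {j : ℕ} (hj : j < n) : modelT d n j ^ (d - 1) * modelT d n j = 1 := by
  rw [← pow_succ, Nat.sub_add_cancel (Nat.pos_of_ne_zero (NeZero.ne d)), modelT_pow_d hj]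

/-- In each model a left inverse of a square matrix over a commutative ring is two-sided. -/
lemma isUnit_of_left_inverse {a b : ModelAlg d n} (h : b * a = 1) : IsUnit a :=
  Pi.isUnit_iff.2 fun θ =>
    have hθ : b θ * a θ = 1 := congrFun h θ
    ⟨⟨a θ, b θ, mul_eq_one_symm hθ, hθ⟩, rfl⟩

lemma isUnit_modelGen (a : Gen n) : IsUnit (modelGen (d := d) a) := by
  rcases a with ⟨i, hi⟩ | j
  · exact isUnit_of_left_inverse (sub_mul_modelG hi)
  · exact isUnit_of_left_inverse (modelT_pow_mul j.2)

lemma modelT_mul_modelG (i : ℕ) (hi : i + 1 < n) (j : Fin n) :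
    modelT d n j * modelG d n i = modelG d n i * modelT d n (strandSwap i hi j) := by
  by_cases h1 : (j : ℕ) = i
  · obtain rfl : j = ⟨i, Nat.lt_of_succ_lt hi⟩ := Fin.ext h1
    rw [strandSwap_left]
    exact isYokonumaSystem_model.framing_left i hi
  · by_cases h2 : (j : ℕ) = i + 1
    · obtain rfl : j = ⟨i + 1, hi⟩ := Fin.ext h2
      rw [strandSwap_right]
      exact isYokonumaSystem_model.framing_right i hi
    · rw [strandSwap_of_ne _ _ _ h1 h2]
      exact isYokonumaSystem_model.framing_far i j hi j.2 h1 h2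

variable (d n) in
/-- The modular framed braid group acts on the models. -/
def modelHom : ModularFramedBraidGroup d n →* (ModelAlg d n)ˣ :=
  PresentedGroup.toGroup (f := fun a => (isUnit_modelGen a).unit) (by
    rintro r (⟨w, h⟩ | j)
    · rcases h with ⟨i, hi, hj⟩ | ⟨i, j, hi, hj, hij⟩ | ⟨i, j⟩ | ⟨i, hi, j⟩ <;>
      rw [map_mul, map_inv, mul_inv_eq_one] <;> ext1 <;>
      simp only [wordSigma, wordFraming, map_mul, FreeGroup.lift_apply_of, Units.val_mul,
        IsUnit.unit_spec, modelGen]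
      · exact isYokonumaSystem_model.braid i hj
      · exact isYokonumaSystem_model.comm i j hij hj
      · exact isYokonumaSystem_model.framing_comm i j i.2 j.2
      · exact modelT_mul_modelG i hi j
    · ext1
      simp only [wordFraming, map_pow, FreeGroup.lift_apply_of, Units.val_pow_eq_pow_val,
        IsUnit.unit_spec, modelGen, Units.val_one]
      exact modelT_pow_d j.2)

variable (d n) in
/-- The group algebra of the modular framed braid group acts on the models. -/
def modelRep : MonoidAlgebra ℂ (ModularFramedBraidGroup d n) →ₐ[ℂ] ModelAlg d n :=
  MonoidAlgebra.lift ℂ _ _ ((Units.coeHom _).comp (modelHom d n))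

lemma modelRep_of (w : ModularFramedBraidGroup d n) :
    modelRep d n (MonoidAlgebra.of ℂ _ w) = modelHom d n w := by
  simp [modelRep]

lemma modelHom_msigma (i : ℕ) (hi : i + 1 < n) :
    (modelHom d n (msigma d i hi) : ModelAlg d n) = modelG d n i := by
  simp [modelHom, msigma, modelGen]

lemma modelHom_mframing (j : Fin n) :
    (modelHom d n (mframing d j) : ModelAlg d n) = modelT d n j := by
  simp [modelHom, mframing, modelGen]

lemma modelHom_mem (w : ModularFramedBraidGroup d n) :
    (modelHom d n w : ModelAlg d n) ∈ modelSubalgebra d n := by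
  suffices h : (modelHom d n w : ModelAlg d n) ∈ modelSubalgebra d n ∧
      (modelHom d n w⁻¹ : ModelAlg d n) ∈ modelSubalgebra d n from h.1
  have hw : w ∈ Subgroup.closure (Set.range
      (PresentedGroup.of (rels := {w | ModularRel d n w}))) := by
    rw [PresentedGroup.closure_range_of]; trivial
  have ht : ∀ j < n, modelT d n j ∈ modelSubalgebra d n := fun j hj =>
    t_mem_strandAlgebra (Nat.zero_le j) hj
  induction hw using Subgroup.closure_induction with
  | mem w hw =>
    obtain ⟨⟨i, hi⟩ | j, rfl⟩ := hw
    · have hg : modelG d n i ∈ modelSubalgebra d n := g_mem_strandAlgebra (Nat.zero_le i) hi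
      refine ⟨by rw [← msigma, modelHom_msigma]; exact hg, ?_⟩
      have e : ((modelHom d n (msigma d i hi)⁻¹ : (ModelAlg d n)ˣ) : ModelAlg d n) =
          modelG d n i - rParam d • modelIdem d n i := by
        refine (left_inv_eq_right_inv (sub_mul_modelG hi) ?_).symm
        rw [← modelHom_msigma i hi, ← Units.val_mul, ← map_mul, mul_inv_cancel, map_one,
          Units.val_one]
      -- The subalgebra is taken over the parameter ring, so the complex scalar 1/d is first moved
      -- there.
      rw [← msigma, e, modelIdem, ← algebraMap_smul (ParamRing d) (1 / (d : ℂ))]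
      exact sub_mem hg (Subalgebra.smul_mem _ (Subalgebra.smul_mem _ (sum_mem fun s _ =>
        mul_mem (pow_mem (ht i (by omega)) _) (pow_mem (ht _ hi) _)) _) _)
    · refine ⟨by rw [← mframing, modelHom_mframing]; exact ht j j.2, ?_⟩
      have e : ((modelHom d n (mframing d j)⁻¹ : (ModelAlg d n)ˣ) : ModelAlg d n) =
          modelT d n j ^ (d - 1) := by
        refine (left_inv_eq_right_inv (modelT_pow_mul j.2) ?_).symm
        rw [← modelHom_mframing j, ← Units.val_mul, ← map_mul, mul_inv_cancel, map_one,
          Units.val_one]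
      rw [← mframing, e]
      exact pow_mem (ht j j.2) _
  | one => simp [one_mem]
  | mul x y _ _ h1 h2 =>
    rw [mul_inv_rev, map_mul, map_mul, Units.val_mul, Units.val_mul]
    exact ⟨mul_mem h1.1 h2.1, mul_mem h2.2 h1.2⟩
  | inv x _ h => rw [inv_inv]; exact h.symm

lemma modelRep_mem (a : MonoidAlgebra ℂ (ModularFramedBraidGroup d n)) :
    modelRep d n a ∈ modelSubalgebra d n := by
  induction a using MonoidAlgebra.induction_on with
  | of w => rw [modelRep_of]; exact modelHom_mem w
  | add a b ha hb => rw [map_add]; exact add_mem ha hb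
  | smul r a ha =>
    rw [map_smul, ← algebraMap_smul (ParamRing d) r]
    exact Subalgebra.smul_mem _ ha _

lemma modelHom_addStrand (w : ModularFramedBraidGroup d n) :
    (modelHom d (n + 1) (addStrand d n w) : ModelAlg d (n + 1)) =
      modelIncl d n (modelHom d n w) := by
  have h : (modelHom d (n + 1)).comp (addStrand d n) =
      (Units.map (modelIncl d n : ModelAlg d n →* ModelAlg d (n + 1))).comp (modelHom d n) := by
    refine PresentedGroup.ext fun a => Units.ext ?_
    rcases a with ⟨i, hi⟩ | j
    · refine (?_ : ((modelHom d (n + 1) (addStrand d n (msigma d i hi)) : (ModelAlg d (n + 1))ˣ) :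
        ModelAlg d (n + 1)) = modelIncl d n (modelHom d n (msigma d i hi)))
      rw [addStrand_msigma, modelHom_msigma, modelHom_msigma, modelIncl_modelG hi]
    · refine (?_ : ((modelHom d (n + 1) (addStrand d n (mframing d j)) : (ModelAlg d (n + 1))ˣ) :
        ModelAlg d (n + 1)) = modelIncl d n (modelHom d n (mframing d j)))
      rw [addStrand_mframing, modelHom_mframing, modelHom_mframing, modelIncl_modelT j.2]
      rfl
  exact congrArg Units.val (DFunLike.congr_fun h w)

lemma modelRep_incl (a : MonoidAlgebra ℂ (ModularFramedBraidGroup d n)) :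
    modelRep d (n + 1) (groupAlgebraIncl d n a) = modelIncl d n (modelRep d n a) := by
  induction a using MonoidAlgebra.induction_on with
  | of w => rw [groupAlgebraIncl_of, modelRep_of, modelRep_of, modelHom_addStrand]
  | add a b ha hb => simp only [map_add, ha, hb]
  | smul r a ha =>
    rw [map_smul, map_smul, map_smul, ha, ← algebraMap_smul (ParamRing d) r,
      ← algebraMap_smul (ParamRing d) r, map_smul]

lemma modelRep_idem (i : ℕ) (hi : i + 1 < n) : modelRep d n (idem d i hi) = modelIdem d n i := by
  rw [idem_eq, modelIdem]
  simp only [map_smul, map_sum, modelRep_of, map_mul, map_pow, modelHom_mframing]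

variable (d n) in
/-- The generic Markov trace on the group algebra of the modular framed braid group. -/
def genericTrace : MonoidAlgebra ℂ (ModularFramedBraidGroup d n) →ₗ[ℂ] ParamRing d :=
  ((LinearEquiv.ofInjective (evalModels d).toLinearMap
    (evalModels_injective d)).symm.restrictScalars ℂ).toLinearMap.comp
  (LinearMap.codRestrict ((LinearMap.range (evalModels d).toLinearMap).restrictScalars ℂ)
    (((modelTrace d n).restrictScalars ℂ).comp (modelRep d n).toLinearMap)
    fun a => modelTrace_mem_range _ (modelRep_mem a))

lemma evalModels_genericTrace (a : MonoidAlgebra ℂ (ModularFramedBraidGroup d n)) :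
    evalModels d (genericTrace d n a) = modelTrace d n (modelRep d n a) := by
  have h := LinearEquiv.ofInjective_symm_apply (f := (evalModels d).toLinearMap)
    (h := evalModels_injective d) ⟨modelTrace d n (modelRep d n a),
      modelTrace_mem_range _ (modelRep_mem a)⟩
  exact h

/-- Transfers the Markov rules from the models to the parameter ring, by injectivity of
`evalModels`. -/
lemma genericTrace_eq_mul {m : ℕ} {a : MonoidAlgebra ℂ (ModularFramedBraidGroup d n)}
    {b : MonoidAlgebra ℂ (ModularFramedBraidGroup d m)} {p : ParamRing d}
    (h : modelTrace d n (modelRep d n a) = p • modelTrace d m (modelRep d m b)) :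
    genericTrace d n a = p * genericTrace d m b := by
  apply evalModels_injective d
  rw [map_mul, evalModels_genericTrace, evalModels_genericTrace, h, Algebra.smul_def]
  rfl

lemma genericTrace_mul_comm (a b : MonoidAlgebra ℂ (ModularFramedBraidGroup d n)) :
    genericTrace d n (a * b) = genericTrace d n (b * a) := by
  apply evalModels_injective d
  rw [evalModels_genericTrace, evalModels_genericTrace, map_mul (modelRep d n),
    map_mul (modelRep d n), modelTrace_mul_comm _ (modelRep_mem b)]

lemma genericTrace_zero_one : genericTrace d 0 1 = 1 := by
  apply evalModels_injective d
  rw [evalModels_genericTrace, map_one (modelRep d 0), map_one (evalModels d),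
    modelTrace_zero_one]

lemma genericTrace_incl (a : MonoidAlgebra ℂ (ModularFramedBraidGroup d n)) :
    genericTrace d (n + 1) (groupAlgebraIncl d n a) = xParam d 0 * genericTrace d n a :=
  genericTrace_eq_mul (by rw [modelRep_incl, modelTrace_incl])

lemma genericTrace_incl_mul_framing (a : MonoidAlgebra ℂ (ModularFramedBraidGroup d n)) (s : ℕ) :
    genericTrace d (n + 1) (groupAlgebraIncl d n a *
      MonoidAlgebra.of ℂ _ (mframing d (Fin.last n)) ^ s) = xParam d s * genericTrace d n a :=
  genericTrace_eq_mul (by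
    rw [map_mul, map_pow, modelRep_incl, modelRep_of, modelHom_mframing, Fin.val_last,
      modelTrace_incl_mul_modelT_pow])

lemma genericTrace_incl_mul_sigma (a : MonoidAlgebra ℂ (ModularFramedBraidGroup d (n + 1))) :
    genericTrace d (n + 2) (groupAlgebraIncl d (n + 1) a *
      MonoidAlgebra.of ℂ _ (msigma d n (Nat.lt_succ_self (n + 1)))) =
        zParam d * genericTrace d (n + 1) a :=
  genericTrace_eq_mul (by
    rw [map_mul, modelRep_incl, modelRep_of, modelHom_msigma, modelTrace_incl_mul_modelG])

/-- The parameter r of the quadratic relation is still an indeterminate here, so this is a relation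
between trace values rather than one in ℂF_{d,n}. Arbitrary factors a and b on both sides are what
the descent to the quotient by a two-sided ideal requires. -/
lemma genericTrace_quad (i : ℕ) (hi : i + 1 < n)
    (a b : MonoidAlgebra ℂ (ModularFramedBraidGroup d n)) :
    genericTrace d n (a * MonoidAlgebra.of ℂ _ (msigma d i hi) ^ 2 * b) =
      genericTrace d n (a * b) + rParam d *
        genericTrace d n (a * (idem d i hi * MonoidAlgebra.of ℂ _ (msigma d i hi)) * b) := by
  apply evalModels_injective d
  rw [map_add, map_mul (evalModels d), evalModels_genericTrace, evalModels_genericTrace,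
    evalModels_genericTrace]
  simp only [map_mul (modelRep d n), map_pow (modelRep d n), modelRep_of, modelHom_msigma,
    modelRep_idem]
  rw [sq, modelG_mul_self hi, mul_add, add_mul, map_add, mul_one, mul_smul_comm, smul_mul_assoc,
    map_smul, Algebra.smul_def]
  rfl

/-! ### Existence of the Juyumaya trace -/

variable (d) in
/-- The indeterminate `x_s`, with indices modulo `d` and `x_0 = 1`. -/
def xMod (s : ZMod d) : TracePoly d :=
  if h : s.val = 0 then 1 else xVar d ⟨s.val - 1, by have := ZMod.val_lt s; omega⟩

variable (d) in
/-- The specialization of the generic parameters at `r = q - q⁻¹`, at `z`, and at the Fourier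
transform of `x_0, …, x_{d-1}`. -/
def specializeParam (q : ℂ) : ParamRing d →ₐ[ℂ] TracePoly d :=
  MvPolynomial.aeval fun o => match o with
    | none => algebraMap ℂ _ (q - q⁻¹)
    | some none => zVar d
    | some (some χ) => (1 / (d : ℂ)) • ∑ s : ZMod d, rootChar d (TracePoly d) (-s * χ) * xMod d s

lemma specializeParam_rParam (q : ℂ) :
    specializeParam d q (rParam d) = algebraMap ℂ _ (q - q⁻¹) := by
  simp [specializeParam, rParam]

lemma specializeParam_zParam (q : ℂ) : specializeParam d q (zParam d) = zVar d := by
  simp [specializeParam, zParam]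

/-- Fourier inversion on ℤ/dℤ: the y_χ are specialized to the transform of the x_s exactly so that
∑_χ exp(2πi sχ/d) y_χ returns x_s. -/
lemma specializeParam_xParam (q : ℂ) (s : ℕ) :
    specializeParam d q (xParam d s) = xMod d (s : ZMod d) := by
  have hd : (d : ℂ) ≠ 0 := Nat.cast_ne_zero.mpr (NeZero.ne d)
  have h1 : ∀ χ : ZMod d, specializeParam d q (rootChar d (ParamRing d) χ ^ s * yParam d χ) =
      ∑ s' : ZMod d, (1 / (d : ℂ)) •
        (algebraMap ℂ (TracePoly d) (ZMod.stdAddChar (χ * ((s : ZMod d) - s'))) * xMod d s') := by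
    intro χ
    rw [rootChar_pow, map_mul, rootChar, AlgHom.commutes]
    have e : specializeParam d q (yParam d χ) =
        (1 / (d : ℂ)) • ∑ s : ZMod d, rootChar d (TracePoly d) (-s * χ) * xMod d s := by
      simp [specializeParam, yParam]
    rw [e, mul_smul_comm, Finset.mul_sum, Finset.smul_sum]
    refine Finset.sum_congr rfl fun s' _ => ?_
    rw [rootChar, ← mul_assoc, ← map_mul, ← AddChar.map_add_eq_mul]
    congr 4
    ring
  rw [xParam, map_sum, Finset.sum_congr rfl fun χ _ => h1 χ, Finset.sum_comm,
    Finset.sum_eq_single (s : ZMod d)]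
  · simp only [sub_self, mul_zero, AddChar.map_zero_eq_one, map_one, one_mul, Finset.sum_const,
      Finset.card_univ, ZMod.card]
    rw [← Nat.cast_smul_eq_nsmul ℂ, smul_smul, mul_one_div_cancel hd, one_smul]
  · intro s' _ hne
    rw [← Finset.smul_sum, ← Finset.sum_mul, ← map_sum,
      AddChar.sum_mulShift _ (ZMod.isPrimitive_stdAddChar d),
      if_neg (sub_ne_zero.2 hne.symm)]
    simp
  · simp

end

/-- A linear functional on an algebra that respects a relation under left and right multiplication
descends to the quotient by this relation. -/
lemma exists_ringQuot_functional {k B P : Type*} [CommRing k] [Ring B] [Algebra k B]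
    [AddCommGroup P] [Module k P] (r : B → B → Prop) (f : B →ₗ[k] P)
    (h : ∀ x y, r x y → ∀ a b, f (a * x * b) = f (a * y * b)) :
    ∃ f' : RingQuot r →ₗ[k] P, ∀ a, f' (RingQuot.mkAlgHom k r a) = f a := by
  -- The largest congruence that f cannot detect under two-sided multiplication. It contains r, so
  -- the quotient by r maps onto the quotient by it, and the kernel of the quotient map lies in the
  -- kernel of f.
  let c : RingCon B :=
    { r := fun x y => ∀ a b, f (a * x * b) = f (a * y * b)
      iseqv := ⟨fun _ _ _ => rfl, fun h a b => (h a b).symm,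
        fun h h' a b => (h a b).trans (h' a b)⟩
      add' := fun h h' a b => by
        simp only [mul_add, add_mul, map_add, h a b, h' a b]
      mul' := fun {w x y z} h h' a b => by
        have h1 := h a (y * b)
        have h2 := h' (a * x) b
        simp only [← mul_assoc] at h1 h2 ⊢
        exact h1.trans h2 }
  let φ : RingQuot r →ₐ[k] c.Quotient := RingQuot.liftAlgHom k
    ⟨c.mkₐ k, fun {x y} hxy => (RingCon.eq c).2 (h x y hxy)⟩
  have hker : LinearMap.ker (RingQuot.mkAlgHom k r).toLinearMap ≤ LinearMap.ker f := by
    intro x hx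
    rw [LinearMap.mem_ker] at hx ⊢
    have h1 : φ (RingQuot.mkAlgHom k r x) = c.mkₐ k x := RingQuot.liftAlgHom_mkAlgHom_apply ..
    have h2 : RingQuot.mkAlgHom k r x = 0 := hx
    rw [h2, map_zero, ← map_zero (c.mkₐ k)] at h1
    have h3 : c 0 x := (RingCon.eq c).1 h1
    have h4 := h3 1 1
    simpa using h4.symm
  have hs : Function.Surjective (RingQuot.mkAlgHom k r).toLinearMap :=
    RingQuot.mkAlgHom_surjective k r
  let e := (RingQuot.mkAlgHom k r).toLinearMap.quotKerEquivOfSurjective hs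
  refine ⟨((LinearMap.ker (RingQuot.mkAlgHom k r).toLinearMap).liftQ f hker).comp
    e.symm.toLinearMap, fun a => ?_⟩
  have ha : e (Submodule.Quotient.mk a) = RingQuot.mkAlgHom k r a := rfl
  rw [← ha]
  simp

section

variable {d : ℕ} [NeZero d] {q : ℂ}

omit [NeZero d] in
lemma incl_toYH (n : ℕ) (a : MonoidAlgebra ℂ (ModularFramedBraidGroup d n)) :
    incl d q n (toYH d q n a) = toYH d q (n + 1) (groupAlgebraIncl d n a) :=
  RingQuot.liftAlgHom_mkAlgHom_apply ..

variable (d q) in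
/-- The Juyumaya trace exists. -/
theorem exists_isJuyumayaTrace :
    ∃ T : ∀ n : ℕ, YH d q n →ₗ[ℂ] TracePoly d, IsJuyumayaTrace d q T := by
  have hdesc : ∀ n : ℕ, ∃ T : YH d q n →ₗ[ℂ] TracePoly d, ∀ a,
      T (toYH d q n a) = specializeParam d q (genericTrace d n a) := by
    intro n
    refine exists_ringQuot_functional (QuadRel d q n)
      ((specializeParam d q).toLinearMap.comp (genericTrace d n)) ?_
    rintro _ _ ⟨i, hi⟩ a b
    rw [LinearMap.comp_apply, LinearMap.comp_apply, genericTrace_quad, mul_add, add_mul, mul_one,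
      mul_smul_comm, smul_mul_assoc, map_add (genericTrace d n), map_smul (genericTrace d n),
      AlgHom.toLinearMap_apply, AlgHom.toLinearMap_apply, map_add, map_add,
      map_mul (specializeParam d q), map_smul, specializeParam_rParam, Algebra.smul_def]
  choose T hT using hdesc
  have hsurj : ∀ n, Function.Surjective (toYH d q n) := fun n =>
    RingQuot.mkAlgHom_surjective ℂ (QuadRel d q n)
  -- This normalization makes the specialized traces compatible with adding a strand.
  have hx0 : specializeParam d q (xParam d 0) = 1 := by
    rw [specializeParam_xParam]; simp [xMod]
  have hincl : ∀ (n : ℕ) (a : YH d q n), T (n + 1) (incl d q n a) = T n a := by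
    intro n a
    obtain ⟨a, rfl⟩ := hsurj n a
    rw [incl_toYH, hT, hT, genericTrace_incl, map_mul, hx0, one_mul]
  refine ⟨T, hincl, ?_, ?_, ?_, ?_⟩
  · intro n a b
    obtain ⟨a, rfl⟩ := hsurj n a
    obtain ⟨b, rfl⟩ := hsurj n b
    rw [← map_mul, ← map_mul, hT, hT, genericTrace_mul_comm]
  · intro n
    induction n with
    | zero => rw [← map_one (toYH d q 0), hT, genericTrace_zero_one, map_one]
    | succ n ih => rw [← map_one (incl d q n), hincl, ih]
  · intro n a
    obtain ⟨a, rfl⟩ := hsurj _ a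
    rw [incl_toYH, g, ← map_mul, hT, hT, genericTrace_incl_mul_sigma, map_mul,
      specializeParam_zParam]
  · intro n a k
    obtain ⟨a, rfl⟩ := hsurj _ a
    have hk : (((k : ℕ) + 1 : ℕ) : ZMod d).val = (k : ℕ) + 1 :=
      ZMod.val_cast_of_lt (by have := k.2; omega)
    have hx : xMod d (((k : ℕ) + 1 : ℕ) : ZMod d) = xVar d k := by
      rw [xMod, dif_neg (by rw [hk]; omega)]
      congr 1
      ext
      simp only [hk, Nat.add_sub_cancel]
    rw [incl_toYH, t, ← map_pow, ← map_mul, hT, hT, genericTrace_incl_mul_framing, map_mul,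
      specializeParam_xParam, hx]

-- Existence selects the first branch in the definition of `tr`. Uniqueness is not needed, since the
-- product formula holds for any family obeying the rules.
variable (d q) in
theorem isJuyumayaTrace_tr : IsJuyumayaTrace d q (tr d q) := by
  have h := exists_isJuyumayaTrace d q
  rw [tr, dif_pos h]
  exact h.choose_spec

end

end YokonumaHecke

end

theorem mainTheorem10 (d : ℕ) [NeZero d] (q : ℂ) (hq : q ≠ 0) (n m : ℕ) (hm : 1 ≤ m)
    (c : Fin (m + 1) → ℕ) (hc0 : c 0 = 0) (hc : StrictMono c) (hcn : c (Fin.last m) ≤ n)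
    (α : Fin m → YokonumaHecke.FramedBraidGroup n)
    (hα : ∀ j : Fin m, α j ∈ YokonumaHecke.strandBlock n (c j.castSucc) (c j.succ)) :
    (YokonumaHecke.tr d q n (YokonumaHecke.braidToYH d q n (List.ofFn α).prod) =
      ∏ j : Fin m, YokonumaHecke.tr d q n (YokonumaHecke.braidToYH d q n (α j))) ∧
    (∀ x : ZMod d → ℂ, YokonumaHecke.IsESolution d x →
      YokonumaHecke.specializedTr d q x n
          (YokonumaHecke.braidToYH d q n (List.ofFn α).prod) =
        ∏ j : Fin m, YokonumaHecke.specializedTr d q x n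
          (YokonumaHecke.braidToYH d q n (α j))) ∧
    (∀ D : Finset (ZMod d), D.Nonempty →
      YokonumaHecke.trD d q D n (YokonumaHecke.braidToYH d q n (List.ofFn α).prod) =
        ∏ j : Fin m, YokonumaHecke.trD d q D n (YokonumaHecke.braidToYH d q n (α j))) := by
  have h := ((YokonumaHecke.isJuyumayaTrace_tr d q).map_braid_prod c hc.monotone hcn α hα).2
  have hx : ∀ x : ZMod d → ℂ, YokonumaHecke.specializedTr d q x n
      (YokonumaHecke.braidToYH d q n (List.ofFn α).prod) =
        ∏ j : Fin m, YokonumaHecke.specializedTr d q x n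
          (YokonumaHecke.braidToYH d q n (α j)) := by
    -- Specialization of the x_s is an algebra homomorphism, so it carries the product formula from
    -- ℂ[z, x_1, …, x_{d-1}] to ℂ[z].
    intro x
    simp only [YokonumaHecke.specializedTr, LinearMap.comp_apply, AlgHom.toLinearMap_apply]
    rw [h, map_prod]
  exact ⟨h, fun x _ => hx x, fun D _ => hx (YokonumaHecke.eSolution d D)⟩
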